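/- Let $a,b$ be coprime positive integers and let $k$ be a field whose characteristic divides $a$. Let $A=k[s^a,s^b]\subseteq k[s]$, graded by $\deg s=1$. For $m\ge 0$ and $n\in\mathbb{Z}$ let $\mathbf{H}_{m,n}\subseteq \mathrm{HH}^m(A)$ be the space of classes of Hochschild $m$-cocycles of weight $n$, where a $k$-multilinear cochain $f\colon A^{m}\to A$ has weight $n$ if $f(A_{d_1}\times\cdots\times A_{d_m})\subseteq A_{d_1+\cdots+d_m+n}$ for all $d_1,\dots,d_m$. Then $\mathrm{HH}^m(A)=\bigoplus_{n\in\mathbb{Z}}\mathbf{H}_{m,n}$ for every $m\ge 0$, every $\mathbf{H}_{m,n}$ is finite-dimensional over $k$, and the Hilbert series $\mathcal{H}_{\mathrm{HH}^*(A)}(x,y)=\sum_{m\ge 0,\,n\in\mathbb{Z}}\dim_k(\mathbf{H}_{m,n})\,x^m y^n$ is, as a power series in $x$ whose coefficients are Laurent series in $y$, $$\mathcal{H}_{\mathrm{HH}^*(A)}(x,y)=\left(1+\frac{x^2y^{-ab}}{1-x^2y^{-ab}}\cdot\left(1-y^{m_2}\right)\right)\cdot\left(1+xy^{-b}\right)\cdot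 \mathrm{H}_1,$$ where $m_2=a(b-1)$ and $\mathrm{H}_1=\sum_{d\ge 0}\dim_k(A_d)\,y^d$ is the Hilbert series of $A$. -/

import Mathlib

open Polynomial

noncomputable section

/-! ### Hochschild cohomology of an algebra, via the standard (bar) cochain complex -/

section Hochschild

variable (k : Type*) [Field k] (A : Type*) [Ring A] [Algebra k A]

/-- Hochschild `n`-cochains of `A` with coefficients in `A`: the `k`-multilinear maps
`A × ⋯ × A → A` in `n` variables, i.e. `Hom_k(A^{⊗ n}, A)`. -/
def HochschildCochain (n : ℕ) : Type _ :=
  MultilinearMap k (fun _ : Fin n => A) A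

instance (n : ℕ) : AddCommGroup (HochschildCochain k A n) :=
  inferInstanceAs (AddCommGroup (MultilinearMap k (fun _ : Fin n => A) A))

instance (n : ℕ) : Module k (HochschildCochain k A n) :=
  inferInstanceAs (Module k (MultilinearMap k (fun _ : Fin n => A) A))

instance (n : ℕ) : FunLike (HochschildCochain k A n) (Fin n → A) A :=
  inferInstanceAs (FunLike (MultilinearMap k (fun _ : Fin n => A) A) (Fin n → A) A)

variable {k A}

theorem HochschildCochain.add_apply {n : ℕ} (f g : HochschildCochain k A n) (x : Fin n → A) :
    (f + g) x = f x + g x := rfl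

theorem HochschildCochain.smul_apply {n : ℕ} (c : k) (f : HochschildCochain k A n)
    (x : Fin n → A) : (c • f) x = c • f x := rfl

theorem HochschildCochain.zero_apply {n : ℕ} (x : Fin n → A) :
    (0 : HochschildCochain k A n) x = 0 := rfl

theorem HochschildCochain.neg_apply {n : ℕ} (f : HochschildCochain k A n) (x : Fin n → A) :
    (-f) x = -f x := rfl

theorem HochschildCochain.map_update_add {n : ℕ} (f : HochschildCochain k A n) (x : Fin n → A)
    (i : Fin n) (u v : A) : f (Function.update x i (u + v)) =
      f (Function.update x i u) + f (Function.update x i v) :=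
  MultilinearMap.map_update_add f x i u v

theorem HochschildCochain.map_update_smul {n : ℕ} (f : HochschildCochain k A n) (x : Fin n → A)
    (i : Fin n) (c : k) (u : A) : f (Function.update x i (c • u)) =
      c • f (Function.update x i u) :=
  MultilinearMap.map_update_smul f x i c u

@[ext] theorem HochschildCochain.ext {n : ℕ} {f g : HochschildCochain k A n}
    (h : ∀ x, f x = g x) : f = g := DFunLike.ext f g h

theorem HochschildCochain.sum_apply {n : ℕ} {ι : Type*} (s : Finset ι)
    (f : ι → HochschildCochain k A n) (x : Fin n → A) : (∑ i ∈ s, f i) x = ∑ i ∈ s, f i x :=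
  map_sum (⟨⟨fun f : HochschildCochain k A n => f x, rfl⟩, fun _ _ => rfl⟩ :
    HochschildCochain k A n →+ A) f s

/-- Replacing the `p`-th entry of a tuple replaces one entry of the contracted tuple, by a value
that depends linearly on the new entry. -/
theorem exists_contractNth_update {n : ℕ} (j : Fin n) (x : Fin (n + 1) → A) (p : Fin (n + 1)) :
    ∃ (q : Fin n) (L : A →ₗ[k] A), ∀ v : A,
      Fin.contractNth j.castSucc (· * ·) (Function.update x p v) =
        Function.update (Fin.contractNth j.castSucc (· * ·) x) q (L v) := by
  rcases lt_trichotomy (p : ℕ) (j : ℕ) with h | h | h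
  · refine ⟨⟨p, by omega⟩, LinearMap.id, fun v => ?_⟩
    ext i
    simp only [Fin.contractNth, Function.update_apply, Fin.ext_iff, Fin.val_castSucc,
      Fin.val_succ, LinearMap.id_apply]
    split_ifs <;> first | rfl | omega
  · refine ⟨j, LinearMap.mulRight k (x j.succ), fun v => ?_⟩
    ext i
    simp only [Fin.contractNth, Function.update_apply, Fin.ext_iff, Fin.val_castSucc,
      Fin.val_succ, LinearMap.mulRight_apply]
    split_ifs <;> first | rfl | omega | skip
    have : i = j := Fin.ext (by omega)
    subst this
    rfl
  · rcases Nat.lt_or_ge ((j : ℕ) + 1) p with h' | h'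
    · refine ⟨⟨p - 1, by omega⟩, LinearMap.id, fun v => ?_⟩
      ext i
      simp only [Fin.contractNth, Function.update_apply, Fin.ext_iff, Fin.val_castSucc,
        Fin.val_succ, LinearMap.id_apply]
      split_ifs <;> first | rfl | omega
    · refine ⟨j, LinearMap.mulLeft k (x j.castSucc), fun v => ?_⟩
      ext i
      simp only [Fin.contractNth, Function.update_apply, Fin.ext_iff, Fin.val_castSucc,
        Fin.val_succ, LinearMap.mulLeft_apply]
      split_ifs <;> first | rfl | omega | skip
      have : i = j := Fin.ext (by omega)
      subst this
      rfl

/-- `(x₀, …, xₙ) ↦ x₀ * f (x₁, …, xₙ)`. -/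
def HochschildCochain.head {n : ℕ} (f : HochschildCochain k A n) :
    HochschildCochain k A (n + 1) where
  toFun x := x 0 * f (Fin.tail x)
  map_update_add' {inst} x p u v := by
    obtain rfl : inst = instDecidableEqFin _ := Subsingleton.elim _ _
    induction p using Fin.cases with
    | zero => simp [Fin.tail_update_zero, add_mul]
    | succ q =>
      have h (w : A) : Function.update x q.succ w 0 = x 0 :=
        Function.update_of_ne (Fin.succ_ne_zero q).symm _ _
      simp [HochschildCochain.map_update_add, Fin.tail_update_succ, mul_add, h]
  map_update_smul' {inst} x p c u := by
    obtain rfl : inst = instDecidableEqFin _ := Subsingleton.elim _ _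
    induction p using Fin.cases with
    | zero => simp [Fin.tail_update_zero]
    | succ q =>
      have h (w : A) : Function.update x q.succ w 0 = x 0 :=
        Function.update_of_ne (Fin.succ_ne_zero q).symm _ _
      simp [HochschildCochain.map_update_smul, Fin.tail_update_succ, h]

/-- `(x₀, …, xₙ) ↦ f (x₀, …, xⱼ * xⱼ₊₁, …, xₙ)`. -/
def HochschildCochain.inner {n : ℕ} (f : HochschildCochain k A n) (j : Fin n) :
    HochschildCochain k A (n + 1) where
  toFun x := f (Fin.contractNth j.castSucc (· * ·) x)
  map_update_add' {inst} x p u v := by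
    obtain rfl : inst = instDecidableEqFin _ := Subsingleton.elim _ _
    obtain ⟨q, L, hL⟩ := exists_contractNth_update (k := k) j x p
    simp only [hL, map_add, HochschildCochain.map_update_add]
  map_update_smul' {inst} x p c u := by
    obtain rfl : inst = instDecidableEqFin _ := Subsingleton.elim _ _
    obtain ⟨q, L, hL⟩ := exists_contractNth_update (k := k) j x p
    simp only [hL, map_smul, HochschildCochain.map_update_smul]

/-- `(x₀, …, xₙ) ↦ f (x₀, …, xₙ₋₁) * xₙ`. -/
def HochschildCochain.last {n : ℕ} (f : HochschildCochain k A n) :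
    HochschildCochain k A (n + 1) where
  toFun x := f (Fin.init x) * x (Fin.last n)
  map_update_add' {inst} x p u v := by
    obtain rfl : inst = instDecidableEqFin _ := Subsingleton.elim _ _
    induction p using Fin.lastCases with
    | last => simp [Fin.init_update_last, mul_add]
    | cast q =>
      have h (w : A) : Function.update x q.castSucc w (Fin.last n) = x (Fin.last n) :=
        Function.update_of_ne (Fin.castSucc_lt_last q).ne' _ _
      simp [HochschildCochain.map_update_add, Fin.init_update_castSucc, add_mul, h]
  map_update_smul' {inst} x p c u := by
    obtain rfl : inst = instDecidableEqFin _ := Subsingleton.elim _ _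
    induction p using Fin.lastCases with
    | last => simp [Fin.init_update_last]
    | cast q =>
      have h (w : A) : Function.update x q.castSucc w (Fin.last n) = x (Fin.last n) :=
        Function.update_of_ne (Fin.castSucc_lt_last q).ne' _ _
      simp [HochschildCochain.map_update_smul, Fin.init_update_castSucc, h]

theorem HochschildCochain.head_apply {n : ℕ} (f : HochschildCochain k A n)
    (x : Fin (n + 1) → A) : f.head x = x 0 * f (Fin.tail x) := rfl

theorem HochschildCochain.inner_apply {n : ℕ} (f : HochschildCochain k A n) (j : Fin n)
    (x : Fin (n + 1) → A) : f.inner j x = f (Fin.contractNth j.castSucc (· * ·) x) := rfl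

theorem HochschildCochain.last_apply {n : ℕ} (f : HochschildCochain k A n)
    (x : Fin (n + 1) → A) : f.last x = f (Fin.init x) * x (Fin.last n) := rfl

variable (k A)

/-- The Hochschild differential
`(δ f)(x₀, …, xₙ) = x₀ f(x₁, …, xₙ) + ∑_{j < n} (-1)^(j+1) f(x₀, …, xⱼ xⱼ₊₁, …, xₙ)
  + (-1)^(n+1) f(x₀, …, xₙ₋₁) xₙ`. -/
def hochschildDifferential (n : ℕ) :
    HochschildCochain k A n →ₗ[k] HochschildCochain k A (n + 1) where
  toFun f := f.head + ∑ j : Fin n, (-1 : k) ^ ((j : ℕ) + 1) • f.inner j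
    + (-1 : k) ^ (n + 1) • f.last
  map_add' f g := by
    ext x
    simp only [HochschildCochain.add_apply, HochschildCochain.sum_apply,
      HochschildCochain.smul_apply, HochschildCochain.head_apply, HochschildCochain.inner_apply,
      HochschildCochain.last_apply, mul_add, add_mul, smul_add, Finset.sum_add_distrib]
    abel
  map_smul' c f := by
    ext x
    simp only [HochschildCochain.add_apply, HochschildCochain.sum_apply,
      HochschildCochain.smul_apply, HochschildCochain.head_apply, HochschildCochain.inner_apply,
      HochschildCochain.last_apply, mul_smul_comm, smul_mul_assoc, smul_add, Finset.smul_sum,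
      smul_comm c, RingHom.id_apply]

/-- Hochschild `n`-cocycles. -/
def hochschildCocycles (n : ℕ) : Submodule k (HochschildCochain k A n) :=
  LinearMap.ker (hochschildDifferential k A n)

/-- Hochschild `n`-coboundaries (zero for `n = 0`). -/
def hochschildCoboundaries : (n : ℕ) → Submodule k (HochschildCochain k A n)
  | 0 => ⊥
  | n + 1 => LinearMap.range (hochschildDifferential k A n)

/-- The `n`-th Hochschild cohomology `HHⁿ(A)`: cocycles modulo coboundaries. -/
abbrev HochschildCohomology (n : ℕ) : Type _ :=
  hochschildCocycles k A n ⧸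
    (hochschildCoboundaries k A n).comap (hochschildCocycles k A n).subtype

variable {k A}

/-- The cochains of weight `w` with respect to a family `𝒜` of homogeneous pieces of `A`: those
mapping `𝒜 (d 0) × ⋯ × 𝒜 (d (n-1))` into `𝒜 (d 0 + ⋯ + d (n-1) + w)`. -/
def weightCochains (𝒜 : ℤ → Submodule k A) (n : ℕ) (w : ℤ) :
    Submodule k (HochschildCochain k A n) where
  carrier := {f | ∀ (d : Fin n → ℤ) (x : Fin n → A), (∀ i, x i ∈ 𝒜 (d i)) →
    f x ∈ 𝒜 (∑ i, d i + w)}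
  zero_mem' _ _ _ := Submodule.zero_mem _
  add_mem' hf hg d x hx := Submodule.add_mem _ (hf d x hx) (hg d x hx)
  smul_mem' c _ hf d x hx := Submodule.smul_mem _ c (hf d x hx)

/-- The piece `H_{n,w}` of `HHⁿ(A)` of weight `w`: the classes of the cocycles of weight `w`. -/
def hochschildCohomologyPiece (𝒜 : ℤ → Submodule k A) (n : ℕ) (w : ℤ) :
    Submodule k (HochschildCohomology k A n) :=
  ((weightCochains 𝒜 n w).comap (hochschildCocycles k A n).subtype).map
    (Submodule.mkQ _)

end Hochschild

/-! ### The numerical semigroup algebra `k[s^a, s^b]` -/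

section Semigroup

variable (k : Type*) [Field k] (a b : ℕ)

/-- The numerical semigroup algebra `k[s^a, s^b] ⊆ k[s]`. -/
abbrev numericalSemigroupAlgebra : Subalgebra k k[X] :=
  Algebra.adjoin k {X ^ a, X ^ b}

/-- The homogeneous piece of degree `d` of `k[s^a, s^b]`: its elements that are scalar multiples
of `s^d` (only `0` for `d < 0`). -/
def numericalSemigroupPiece (d : ℤ) : Submodule k (numericalSemigroupAlgebra k a b) where
  carrier := {f | ∀ i : ℕ, (f : k[X]).coeff i ≠ 0 → (i : ℤ) = d}
  zero_mem' i hi := by simp at hi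
  add_mem' {f g} hf hg i hi := by
    by_cases h : (f : k[X]).coeff i = 0
    · refine hg i fun h' => hi ?_
      simp [h, h']
    · exact hf i h
  smul_mem' c f hf i hi := hf i fun h => hi (by simp [h])

/-- The Hilbert series `∑_d dim_k(A_d) y^d` of `A = k[s^a, s^b]`, as a Laurent series in `y`. -/
def numericalSemigroupHilbertSeries : LaurentSeries ℚ :=
  HahnSeries.ofPowerSeries ℤ ℚ (PowerSeries.mk fun d : ℕ =>
    (Module.finrank k (numericalSemigroupPiece k a b (d : ℤ)) : ℚ))

end Semigroup

/-! ### Formal series `∑_{m ≥ 0, n ∈ ℤ} c_{m,n} x^m y^n` -/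

/-- Formal series in `x, y`: power series in `x` whose coefficients are Laurent series in `y`. -/
abbrev BigradedSeries : Type := PowerSeries (LaurentSeries ℚ)

/-- The monomial `y^n`, `n ∈ ℤ`. -/
def yPow (n : ℤ) : BigradedSeries := PowerSeries.C (HahnSeries.single n (1 : ℚ))

/-- `F` is the Hilbert series of the family `V m n` of subspaces: every `V m n` is
finite-dimensional, and `F = ∑ dim_k(V m n) x^m y^n`. -/
def IsBigradedHilbertSeries {k : Type*} [Field k] {H : ℕ → Type*} [∀ m, AddCommGroup (H m)]
    [∀ m, Module k (H m)] (V : (m : ℕ) → ℤ → Submodule k (H m)) (F : BigradedSeries) : Prop :=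
  ∀ (m : ℕ) (n : ℤ), Module.Finite k (V m n) ∧
    HahnSeries.coeff (PowerSeries.coeff m F) n = (Module.finrank k (V m n) : ℚ)

end

/-! Write `x = s^a`, `y = s^b`. Then `A = k[x, y] / (x^b - y^a)` is a plane curve, with basis the
monomials `x^i y^j`, `j < a`. For a hypersurface the Hochschild complex can be replaced by a small
complex that is 2-periodic in positive degrees. Let `ξ`, `η` be the differences of the left and
right actions of `x`, `y` on a bimodule `M`, and let `Δx`, `Δy` be the divided differences of `x^b`
and `-y^a`. Then `Δx ξ + Δy η = 0`, because both actions satisfy the relation. The four commuting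
operators form a matrix factorization, which gives a complex with `M` in degree 0 and `M × M` in
every positive degree.

That this complex computes Hochschild cohomology is proved without resolutions. Both complexes are
functors of the bimodule, and both are contracted naturally after replacing `M` by the coinduced
bimodule `Hom_k(A, M)`, into which `M` embeds by `unit` with the `k`-linear retraction `ev`. This is
enough to build weight-preserving comparison maps (`comparison_d`, `comparison_mem`) and a homotopy
from each round trip to the identity (`nullHomotopy_d_add`), by induction on the degree. For the bar
complex the contraction is the identity, since an `(n+1)`-cochain with values in `M` is an
`n`-cochain with values in `Hom_k(A, M)`. For the periodic complex it comes from explicit operators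
and the identities `even_oddH_add` and `odd_evenH_add`.

For `M = A` commutativity gives `ξ = η = 0`, while `Δy = -a y^(a-1) = 0` because the characteristic
divides `a`, and `Δx = b x^(b-1)` is injective because `b` is invertible in `k`. Hence degrees 0 and
1 contribute a shifted copy of `A`, and each degree at least 2 a shifted copy of `A / (s^(a(b-1)))`.
The shift is `i a b` in degree `2i` and `i a b + b` in degree `2i + 1`. Taking dimensions weight by
weight gives the series. -/

noncomputable section

universe u

/-! ### Graded bimodules and coinduced bimodules -/

/-- A bimodule over a commutative `k`-algebra `A` with a family `W` of `k`-subspaces on which the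
homogeneous pieces `𝒜` of `A` act by shifting the index. -/
structure GradedBimodule {k A : Type u} [Field k] [CommRing A] [Algebra k A]
    (𝒜 : ℤ → Submodule k A) where
  carrier : Type u
  [addCommGroup : AddCommGroup carrier]
  [module : Module k carrier]
  /-- the left action -/
  l : A →ₐ[k] Module.End k carrier
  /-- the right action -/
  r : A →ₐ[k] Module.End k carrier
  l_r : ∀ x y m, l x (r y m) = r y (l x m)
  /-- the subspace of elements of a given weight -/
  W : ℤ → Submodule k carrier
  l_mem : ∀ {d e x m}, x ∈ 𝒜 d → m ∈ W e → l x m ∈ W (e + d)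
  r_mem : ∀ {d e x m}, x ∈ 𝒜 d → m ∈ W e → r x m ∈ W (e + d)

namespace GradedBimodule

variable {k A : Type u} [Field k] [CommRing A] [Algebra k A] {𝒜 : ℤ → Submodule k A}

instance : CoeSort (GradedBimodule 𝒜) (Type u) := ⟨carrier⟩

instance (M : GradedBimodule 𝒜) : AddCommGroup M := M.addCommGroup

instance (M : GradedBimodule 𝒜) : Module k M := M.module

/-- A `k`-linear map commuting with both actions. -/
structure IsHom {M N : GradedBimodule 𝒜} (f : M →ₗ[k] N) : Prop where
  map_l : ∀ x m, f (M.l x m) = N.l x (f m)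
  map_r : ∀ x m, f (M.r x m) = N.r x (f m)

/-- A `k`-linear map preserving weights. -/
def IsHomogeneous {M N : GradedBimodule 𝒜} (f : M →ₗ[k] N) : Prop :=
  ∀ ⦃w m⦄, m ∈ M.W w → f m ∈ N.W w

/-- The algebra itself as a bimodule. -/
@[reducible] def regular (𝒜 : ℤ → Submodule k A) [SetLike.GradedMonoid 𝒜] : GradedBimodule 𝒜 where
  carrier := A
  l := Algebra.lmul k A
  r := Algebra.lmul k A
  l_r x y m := mul_left_comm x y m
  W := 𝒜
  l_mem {d e x m} hx hm := by
    rw [add_comm]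
    exact SetLike.mul_mem_graded hx hm
  r_mem {d e x m} hx hm := by
    rw [add_comm]
    exact SetLike.mul_mem_graded hx hm

variable [SetLike.GradedMonoid 𝒜]

/-- The left action of `A` on `Hom_k(A, M)` by right translation of the argument. -/
def coindLeft (k A M : Type u) [Field k] [CommRing A] [Algebra k A] [AddCommGroup M] [Module k M] :
    A →ₐ[k] Module.End k (A →ₗ[k] M) where
  toFun x := LinearMap.lcomp k M (LinearMap.mulRight k x)
  map_one' := by ext; simp
  map_mul' x y := by ext; simp [mul_assoc, mul_comm x y]
  map_zero' := by ext; simp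
  map_add' x y := by ext; simp [mul_add]
  commutes' c := by ext; simp [Algebra.algebraMap_eq_smul_one]

/-- The action of `A` on `Hom_k(A, M)` through the values. -/
def coindRight {k A M : Type u} [Field k] [CommRing A] [Algebra k A] [AddCommGroup M] [Module k M]
    (r : A →ₐ[k] Module.End k M) : A →ₐ[k] Module.End k (A →ₗ[k] M) where
  toFun x := LinearMap.compRight k (r x)
  map_one' := by ext; simp
  map_mul' x y := by ext; simp
  map_zero' := by ext; simp
  map_add' x y := by ext; simp
  commutes' c := by ext; simp

/-- The coinduced bimodule `Hom_k(A, M)`, with `(x g y) z = g (z x) y`. -/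
def coind (M : GradedBimodule 𝒜) : GradedBimodule 𝒜 where
  carrier := A →ₗ[k] M
  l := coindLeft k A M
  r := coindRight M.r
  l_r x y m := rfl
  W d :=
    { carrier := {g | ∀ e, ∀ z ∈ 𝒜 e, g z ∈ M.W (d + e)}
      zero_mem' _ _ _ := zero_mem _
      add_mem' hf hg e z hz := add_mem (hf e z hz) (hg e z hz)
      smul_mem' c _ hf e z hz := Submodule.smul_mem _ c (hf e z hz) }
  l_mem {d e x m} hx hm e' z hz := by
    have := hm _ _ (SetLike.mul_mem_graded hz hx)
    rw [show e + (e' + d) = e + d + e' by ring] at this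
    exact this
  r_mem {d e x m} hx hm e' z hz := by
    have := M.r_mem hx (hm _ z hz)
    rw [show e + e' + d = e + d + e' by ring] at this
    exact this

variable {M N : GradedBimodule 𝒜}

instance : FunLike M.coind A M := inferInstanceAs (FunLike (A →ₗ[k] M) A M)

@[ext] theorem coind_ext {g g' : M.coind} (h : ∀ z, g z = g' z) : g = g' := DFunLike.ext _ _ h

/-- Elements of the coinduced bimodule are `k`-linear maps. -/
def coindEquiv (M : GradedBimodule 𝒜) : M.coind ≃ₗ[k] (A →ₗ[k] M) := LinearEquiv.refl k _

theorem coindEquiv_apply (g : M.coind) (z : A) : coindEquiv M g z = g z := rfl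

theorem coindEquiv_symm_apply (g : A →ₗ[k] M) (z : A) : (coindEquiv M).symm g z = g z := rfl

theorem coind_add_apply (g g' : M.coind) (z : A) : (g + g') z = g z + g' z := rfl

theorem coind_smul_apply (c : k) (g : M.coind) (z : A) : (c • g) z = c • g z := rfl

theorem coind_l_apply (x : A) (g : M.coind) (z : A) : M.coind.l x g z = g (z * x) := rfl

theorem coind_r_apply (x : A) (g : M.coind) (z : A) : M.coind.r x g z = M.r x (g z) := rfl

theorem mem_coind_W {d : ℤ} {g : M.coind} :
    g ∈ M.coind.W d ↔ ∀ e, ∀ z ∈ 𝒜 e, g z ∈ M.W (d + e) := Iff.rfl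

/-- The functor `coind` on `k`-linear maps. -/
def coindMap (f : M →ₗ[k] N) : M.coind →ₗ[k] N.coind :=
  (LinearMap.compRight k f : (A →ₗ[k] M) →ₗ[k] (A →ₗ[k] N))

theorem coindMap_apply (f : M →ₗ[k] N) (g : M.coind) (z : A) : coindMap f g z = f (g z) := rfl

theorem IsHom.coindMap {f : M →ₗ[k] N} (hf : IsHom f) : IsHom (coindMap f) where
  map_l _ _ := rfl
  map_r x g := coind_ext fun z => hf.map_r x (g z)

theorem IsHomogeneous.coindMap {f : M →ₗ[k] N} (hf : IsHomogeneous f) :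
    IsHomogeneous (coindMap f) :=
  fun _ _ hg e z hz => hf (hg e z hz)

variable (M)

/-- The bimodule embedding `m ↦ (z ↦ z m)`. -/
def unit : M →ₗ[k] M.coind := (M.l.toLinearMap.flip : M →ₗ[k] A →ₗ[k] M)

/-- The map `m ↦ (z ↦ m z)`. -/
def central : M →ₗ[k] M.coind := (M.r.toLinearMap.flip : M →ₗ[k] A →ₗ[k] M)

/-- Evaluation at `1`, a `k`-linear retraction of `unit`. -/
def ev : M.coind →ₗ[k] M := (LinearMap.applyₗ (1 : A) : (A →ₗ[k] M) →ₗ[k] M)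

variable {M}

theorem unit_apply (m : M) (z : A) : M.unit m z = M.l z m := rfl

theorem central_apply (m : M) (z : A) : M.central m z = M.r z m := rfl

theorem ev_apply (g : M.coind) : M.ev g = g 1 := rfl

/-- `ev` is only `k`-linear, so it does not commute with differentials. It serves to recover an
element from its image under `unit`, at the end of each computation. -/
theorem ev_comp_unit : M.ev ∘ₗ M.unit = LinearMap.id := by
  ext m
  simp [ev_apply, unit_apply]

theorem isHom_unit : IsHom M.unit where
  map_l x m := coind_ext fun z => by
    rw [coind_l_apply, unit_apply, unit_apply, map_mul]; rfl
  map_r x m := coind_ext fun z => M.l_r z x m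

theorem isHomogeneous_unit : IsHomogeneous M.unit := fun _ _ hm _ _ hz => M.l_mem hz hm

theorem isHomogeneous_central : IsHomogeneous M.central := fun _ _ hm _ _ hz => M.r_mem hz hm

theorem isHomogeneous_ev : IsHomogeneous M.ev := fun w g hg => by
  have := hg 0 1 SetLike.GradedOne.one_mem
  rw [add_zero] at this
  exact this

theorem ev_comp_coindMap (f : M →ₗ[k] N) : N.ev ∘ₗ coindMap f = f ∘ₗ M.ev := rfl

theorem coindMap_comp_unit {f : M →ₗ[k] N} (hf : IsHom f) :
    coindMap f ∘ₗ M.unit = N.unit ∘ₗ f :=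
  LinearMap.ext fun m => coind_ext fun z => hf.map_l z m

theorem coindMap_comp_central {f : M →ₗ[k] N} (hf : IsHom f) :
    coindMap f ∘ₗ M.central = N.central ∘ₗ f :=
  LinearMap.ext fun m => coind_ext fun z => hf.map_r z m

end GradedBimodule

open GradedBimodule

/-! ### Natural complexes, their comparison maps and homotopies -/

/-- A cochain complex depending naturally on a graded bimodule `M`, with `M` in degree `0`, that is
naturally contracted by passing to coinduced bimodules. -/
structure NaturalComplex {k A : Type u} [Field k] [CommRing A] [Algebra k A]
    (𝒜 : ℤ → Submodule k A) [SetLike.GradedMonoid 𝒜] where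
  X : ℕ → GradedBimodule 𝒜 → Type u
  [addCommGroup : ∀ n M, AddCommGroup (X n M)]
  [module : ∀ n M, Module k (X n M)]
  W : ∀ n M, ℤ → Submodule k (X n M)
  map : ∀ n {M N : GradedBimodule 𝒜}, (M →ₗ[k] N) → X n M →ₗ[k] X n N
  map_id : ∀ n (M : GradedBimodule 𝒜), map n (LinearMap.id : M →ₗ[k] M) = LinearMap.id
  map_comp : ∀ n {M N P : GradedBimodule 𝒜} (g : N →ₗ[k] P) (f : M →ₗ[k] N),
    map n (g ∘ₗ f) = map n g ∘ₗ map n f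
  map_mem : ∀ n {M N : GradedBimodule 𝒜} {f : M →ₗ[k] N}, IsHomogeneous f →
    ∀ {w x}, x ∈ W n M w → map n f x ∈ W n N w
  zeroEquiv : ∀ M, X 0 M ≃ₗ[k] M
  zeroEquiv_map : ∀ {M N : GradedBimodule 𝒜} (f : M →ₗ[k] N) x,
    zeroEquiv N (map 0 f x) = f (zeroEquiv M x)
  zeroEquiv_mem : ∀ {M w x}, zeroEquiv M x ∈ M.W w ↔ x ∈ W 0 M w
  d : ∀ n M, X n M →ₗ[k] X (n + 1) M
  d_d : ∀ n M x, d (n + 1) M (d n M x) = 0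
  d_map : ∀ n {M N : GradedBimodule 𝒜} {f : M →ₗ[k] N}, IsHom f →
    ∀ x, d n N (map n f x) = map (n + 1) f (d n M x)
  d_mem : ∀ n {M w x}, x ∈ W n M w → d n M x ∈ W (n + 1) M w
  -- The contraction lands in coinduced coefficients. It plays the role of relative injectivity of
  -- coinduced bimodules, but as an explicit natural operator.
  h : ∀ n M, X (n + 1) M →ₗ[k] X n M.coind
  h_map : ∀ n {M N : GradedBimodule 𝒜} {f : M →ₗ[k] N}, IsHom f →
    ∀ x, h n N (map (n + 1) f x) = map n (coindMap f) (h n M x)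
  h_mem : ∀ n {M w x}, x ∈ W (n + 1) M w → h n M x ∈ W n M.coind w
  -- In degree 0 the contraction has an error term, as the cohomology of a coinduced bimodule there
  -- need not vanish. The error is a cocycle by `d_central`, hence harmless.
  h_d_zero : ∀ (M : GradedBimodule 𝒜) x, h 0 M (d 0 M x) = map 0 M.unit x - map 0 M.central x
  d_central : ∀ (M : GradedBimodule 𝒜) x, d 0 M.coind (map 0 M.central x) = 0
  h_d_add : ∀ n (M : GradedBimodule 𝒜) x,
    h (n + 1) M (d (n + 1) M x) + d n M.coind (h n M x) = map (n + 1) M.unit x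

namespace NaturalComplex

variable {k A : Type u} [Field k] [CommRing A] [Algebra k A] {𝒜 : ℤ → Submodule k A}
  [SetLike.GradedMonoid 𝒜]

instance (F : NaturalComplex 𝒜) (n : ℕ) (M : GradedBimodule 𝒜) : AddCommGroup (F.X n M) :=
  F.addCommGroup n M

instance (F : NaturalComplex 𝒜) (n : ℕ) (M : GradedBimodule 𝒜) : Module k (F.X n M) :=
  F.module n M

theorem map_ev_map_unit (F : NaturalComplex 𝒜) (n : ℕ) {M : GradedBimodule 𝒜} (x : F.X n M) :
    F.map n M.ev (F.map n M.unit x) = x := by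
  rw [← LinearMap.comp_apply, ← F.map_comp, ev_comp_unit, F.map_id, LinearMap.id_apply]

theorem map_ev_map_coindMap (F : NaturalComplex 𝒜) (n : ℕ) {M N : GradedBimodule 𝒜}
    (f : M →ₗ[k] N) (x : F.X n M.coind) :
    F.map n N.ev (F.map n (coindMap f) x) = F.map n f (F.map n M.ev x) := by
  rw [← LinearMap.comp_apply, ← F.map_comp, ev_comp_coindMap, F.map_comp, LinearMap.comp_apply]

/-- The comparison map between two natural complexes. -/
def comparison (F G : NaturalComplex 𝒜) : ∀ (n : ℕ) (M : GradedBimodule 𝒜), F.X n M →ₗ[k] G.X n M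
  | 0, M => (G.zeroEquiv M).symm.toLinearMap ∘ₗ (F.zeroEquiv M).toLinearMap
  -- For a cocycle `x` one has `unit x = d (h x)`, so a natural cochain map must send `x` to `ev (d
  -- (c (h x)))`, with `c` the map one degree lower. The same formula is used on all cochains.
  | n + 1, M => G.map (n + 1) M.ev ∘ₗ G.d n M.coind ∘ₗ comparison F G n M.coind ∘ₗ F.h n M

variable {F G : NaturalComplex 𝒜}

theorem comparison_zero {M : GradedBimodule 𝒜} (x : F.X 0 M) :
    comparison F G 0 M x = (G.zeroEquiv M).symm (F.zeroEquiv M x) := rfl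

theorem comparison_succ (n : ℕ) {M : GradedBimodule 𝒜} (x : F.X (n + 1) M) :
    comparison F G (n + 1) M x =
      G.map (n + 1) M.ev (G.d n M.coind (comparison F G n M.coind (F.h n M x))) := rfl

/-- Unlike in higher degrees, naturality holds here for every `k`-linear map. This is needed for
`central`, which is in general not a bimodule map. -/
theorem comparison_zero_map {M N : GradedBimodule 𝒜} (f : M →ₗ[k] N) (x : F.X 0 M) :
    comparison F G 0 N (F.map 0 f x) = G.map 0 f (comparison F G 0 M x) := by
  apply (G.zeroEquiv N).injective
  simp [comparison_zero, F.zeroEquiv_map, G.zeroEquiv_map]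

theorem comparison_map (n : ℕ) : ∀ {M N : GradedBimodule 𝒜} {f : M →ₗ[k] N}, IsHom f →
    ∀ x : F.X n M, comparison F G n N (F.map n f x) = G.map n f (comparison F G n M x) := by
  induction n with
  | zero => exact fun _ x => comparison_zero_map _ x
  | succ n ih =>
    intro M N f hf x
    rw [comparison_succ, F.h_map n hf, ih hf.coindMap, G.d_map n hf.coindMap,
      map_ev_map_coindMap, ← comparison_succ]

theorem comparison_mem (n : ℕ) : ∀ {M : GradedBimodule 𝒜} {w} {x : F.X n M}, x ∈ F.W n M w →
    comparison F G n M x ∈ G.W n M w := by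
  induction n with
  | zero =>
    intro M w x hx
    rw [← G.zeroEquiv_mem, comparison_zero, LinearEquiv.apply_symm_apply]
    exact F.zeroEquiv_mem.2 hx
  | succ n ih =>
    exact fun hx => G.map_mem _ isHomogeneous_ev (G.d_mem n (ih (F.h_mem n hx)))

/-- In the recursion applied to `d x`, substitute `h (d x) = unit x - d (h x)`. By induction the
second term becomes a double differential and dies; the first is returned by `ev`. In degree 0 the
`central` term dies instead. -/
theorem comparison_d (n : ℕ) : ∀ {M : GradedBimodule 𝒜} (x : F.X n M),
    comparison F G (n + 1) M (F.d n M x) = G.d n M (comparison F G n M x) := by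
  induction n with
  | zero =>
    intro M x
    rw [comparison_succ, F.h_d_zero, map_sub, map_sub, comparison_zero_map, comparison_zero_map,
      G.d_central, sub_zero, G.d_map 0 isHom_unit, map_ev_map_unit]
  | succ n ih =>
    intro M x
    rw [comparison_succ, eq_sub_of_add_eq (F.h_d_add n M x), map_sub, map_sub, ih, G.d_d, sub_zero,
      comparison_map _ isHom_unit, G.d_map _ isHom_unit, map_ev_map_unit]

/-- A natural cochain self-map vanishing in degree `0`. -/
structure IsNullMap (F : NaturalComplex 𝒜) (ζ : ∀ n M, F.X n M →ₗ[k] F.X n M) : Prop where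
  zero : ∀ M x, ζ 0 M x = 0
  map : ∀ n {M N : GradedBimodule 𝒜} {f : M →ₗ[k] N}, IsHom f →
    ∀ x, ζ n N (F.map n f x) = F.map n f (ζ n M x)
  d : ∀ n M x, ζ (n + 1) M (F.d n M x) = F.d n M (ζ n M x)

/-- The natural contraction of a natural self-map vanishing in degree `0`. -/
def nullHomotopy (F : NaturalComplex 𝒜) (ζ : ∀ n M, F.X n M →ₗ[k] F.X n M) :
    ∀ (n : ℕ) (M : GradedBimodule 𝒜), F.X (n + 1) M →ₗ[k] F.X n M
  -- Zero suffices because the self-map vanishes in degree 0.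
  | 0, _ => 0
  | n + 1, M => F.map (n + 1) M.ev ∘ₗ
      (ζ (n + 1) M.coind - F.d n M.coind ∘ₗ nullHomotopy F ζ n M.coind) ∘ₗ F.h (n + 1) M

section

variable {ζ : ∀ n M, F.X n M →ₗ[k] F.X n M}

theorem nullHomotopy_zero {M : GradedBimodule 𝒜} (x : F.X 1 M) : nullHomotopy F ζ 0 M x = 0 := rfl

theorem nullHomotopy_succ (n : ℕ) {M : GradedBimodule 𝒜} (x : F.X (n + 2) M) :
    nullHomotopy F ζ (n + 1) M x = F.map (n + 1) M.ev (ζ (n + 1) M.coind (F.h (n + 1) M x) -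
      F.d n M.coind (nullHomotopy F ζ n M.coind (F.h (n + 1) M x))) := rfl

theorem nullHomotopy_map (hζ : IsNullMap F ζ) (n : ℕ) : ∀ {M N : GradedBimodule 𝒜}
    {f : M →ₗ[k] N}, IsHom f → ∀ x : F.X (n + 1) M,
      nullHomotopy F ζ n N (F.map (n + 1) f x) = F.map n f (nullHomotopy F ζ n M x) := by
  induction n with
  | zero => intro M N f hf x; simp [nullHomotopy_zero]
  | succ n ih =>
    intro M N f hf x
    rw [nullHomotopy_succ, F.h_map _ hf, hζ.map _ hf.coindMap, ih hf.coindMap,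
      F.d_map _ hf.coindMap, ← map_sub, map_ev_map_coindMap, ← nullHomotopy_succ]

/-- Write `s` for the homotopy. Substituting `h (d x) = unit x - d (h x)` in `s (d x)`, the part
from `unit x` gives `ζ x - d (s x)` after `ev`. The other part cancels: by induction at `h x`, `ζ (d
(h x)) = d (ζ (h x)) = d (s (d (h x)))`. -/
theorem nullHomotopy_d_add (hζ : IsNullMap F ζ) (n : ℕ) : ∀ {M : GradedBimodule 𝒜}
    (x : F.X (n + 1) M), ζ (n + 1) M x =
      F.d n M (nullHomotopy F ζ n M x) + nullHomotopy F ζ (n + 1) M (F.d (n + 1) M x) := by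
  induction n with
  | zero =>
    intro M x
    rw [nullHomotopy_succ, eq_sub_of_add_eq (F.h_d_add 0 M x), nullHomotopy_zero,
      nullHomotopy_zero, map_zero, map_zero]
    refine Eq.trans ?_ (zero_add _).symm
    rw [sub_zero, map_sub, hζ.d, hζ.zero, map_zero, sub_zero, hζ.map _ isHom_unit, map_ev_map_unit]
  | succ n ih =>
    intro M x
    rw [nullHomotopy_succ (n + 1), eq_sub_of_add_eq (F.h_d_add (n + 1) M x),
      map_sub (ζ _ _), map_sub (nullHomotopy F ζ _ _), hζ.d,
      hζ.map _ isHom_unit, nullHomotopy_map hζ _ isHom_unit, map_sub (F.d (n + 1) M.coind),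
      eq_sub_of_add_eq' (ih (F.h (n + 1) M x)).symm, map_sub (F.d (n + 1) M.coind), F.d_d,
      F.d_map _ isHom_unit, sub_zero, sub_sub_sub_cancel_right, map_sub, map_ev_map_unit,
      map_ev_map_unit, add_sub_cancel]

end

/-- The identity minus the comparison of `F` with `G` and back. -/
def roundTrip (F G : NaturalComplex 𝒜) (n : ℕ) (M : GradedBimodule 𝒜) : F.X n M →ₗ[k] F.X n M :=
  LinearMap.id - comparison G F n M ∘ₗ comparison F G n M

theorem roundTrip_apply (n : ℕ) (M : GradedBimodule 𝒜) (x : F.X n M) :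
    roundTrip F G n M x = x - comparison G F n M (comparison F G n M x) := rfl

theorem isNullMap_roundTrip : IsNullMap F (roundTrip F G) where
  zero M x := by simp [roundTrip_apply, comparison_zero]
  map n M N f hf x := by
    rw [roundTrip_apply, roundTrip_apply, comparison_map _ hf, comparison_map _ hf, map_sub]
  d n M x := by rw [roundTrip_apply, roundTrip_apply, comparison_d, comparison_d, map_sub]

/-- Coboundaries in degree `n`. -/
def IsCoboundary (F : NaturalComplex 𝒜) : ∀ (n : ℕ) {M : GradedBimodule 𝒜}, F.X n M → Prop
  | 0, _, x => x = 0
  | n + 1, M, x => ∃ y, F.d n M y = x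

theorem isCoboundary_roundTrip (n : ℕ) {M : GradedBimodule 𝒜} {x : F.X n M}
    (hx : F.d n M x = 0) :
    F.IsCoboundary n (x - comparison G F n M (comparison F G n M x)) := by
  rw [← roundTrip_apply]
  cases n with
  | zero => exact isNullMap_roundTrip.zero M x
  | succ n =>
    refine ⟨nullHomotopy F (roundTrip F G) n M x, ?_⟩
    rw [nullHomotopy_d_add isNullMap_roundTrip, hx, map_zero, add_zero]

theorem IsCoboundary.comparison {n : ℕ} {M : GradedBimodule 𝒜} {x : F.X n M}
    (hx : F.IsCoboundary n x) : G.IsCoboundary n (comparison F G n M x) := by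
  cases n with
  | zero => rw [show x = 0 from hx, map_zero]; rfl
  | succ n =>
    obtain ⟨y, rfl⟩ := hx
    exact ⟨_, (comparison_d n y).symm⟩

end NaturalComplex

/-! ### The bar complex as iterated coinduction -/

section contractNth

variable {A : Type*} [Mul A] {n : ℕ} (x : Fin (n + 2) → A)

theorem tail_contractNth_zero :
    Fin.tail (Fin.contractNth (Fin.castSucc 0) (· * ·) x) = Fin.tail (Fin.tail x) := by
  ext i
  simp [Fin.tail, Fin.contractNth]

theorem contractNth_zero_apply_zero :
    Fin.contractNth (Fin.castSucc (0 : Fin (n + 1))) (· * ·) x 0 = x 0 * x (Fin.succ 0) := by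
  simp [Fin.contractNth]

theorem tail_contractNth_succ (j : Fin n) :
    Fin.tail (Fin.contractNth j.succ.castSucc (· * ·) x) =
      Fin.contractNth j.castSucc (· * ·) (Fin.tail x) := by
  ext i
  simp [Fin.tail, Fin.contractNth]

theorem contractNth_succ_apply_zero (j : Fin n) :
    Fin.contractNth j.succ.castSucc (· * ·) x 0 = x 0 := by
  simp [Fin.contractNth]

end contractNth

namespace GradedBimodule

variable {k A : Type u} [Field k] [CommRing A] [Algebra k A] {𝒜 : ℤ → Submodule k A}
  [SetLike.GradedMonoid 𝒜]

/-- The `n`-fold coinduced bimodule; its elements are the `M`-valued `n`-cochains. -/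
@[reducible] def iterCoind : ℕ → GradedBimodule 𝒜 → GradedBimodule 𝒜
  | 0, M => M
  | n + 1, M => iterCoind n M.coind

/-- Functoriality of `iterCoind` in `k`-linear maps. -/
def iterMap : ∀ (n : ℕ) {M N : GradedBimodule 𝒜}, (M →ₗ[k] N) → iterCoind n M →ₗ[k] iterCoind n N
  | 0, _, _, f => f
  | n + 1, _, _, f => iterMap n (coindMap f)

theorem iterMap_id (n : ℕ) : ∀ M : GradedBimodule 𝒜,
    iterMap n (LinearMap.id : M →ₗ[k] M) = LinearMap.id := by
  induction n with
  | zero => exact fun M => rfl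
  | succ n ih => exact fun M => ih M.coind

theorem iterMap_comp (n : ℕ) : ∀ {M N P : GradedBimodule 𝒜} (g : N →ₗ[k] P) (f : M →ₗ[k] N),
    iterMap n (g ∘ₗ f) = iterMap n g ∘ₗ iterMap n f := by
  induction n with
  | zero => exact fun g f => rfl
  | succ n ih => exact fun g f => ih (coindMap g) (coindMap f)

theorem iterMap_mem (n : ℕ) : ∀ {M N : GradedBimodule 𝒜} {f : M →ₗ[k] N}, IsHomogeneous f →
    IsHomogeneous (iterMap n f) := by
  induction n with
  | zero => exact fun h => h
  | succ n ih => exact fun h => ih h.coindMap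

/-- The bar differential. -/
def barD : ∀ (n : ℕ) (M : GradedBimodule 𝒜), iterCoind n M →ₗ[k] iterCoind (n + 1) M
  | 0, M => M.unit - M.central
  -- Split off the first variable. `unit` produces `x₀ f(x₁, …)`; the left action on `Hom_k(A, M)`
  -- multiplies the first two variables, so the remaining terms are those of the lower differential
  -- with opposite sign.
  | n + 1, M => iterMap (n + 1) M.unit - barD n M.coind

theorem barD_succ_apply (n : ℕ) (M : GradedBimodule 𝒜) (x : iterCoind (n + 1) M) :
    barD (n + 1) M x = iterMap (n + 1) M.unit x - barD n M.coind x := rfl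

theorem barD_map (n : ℕ) : ∀ {M N : GradedBimodule 𝒜} {f : M →ₗ[k] N}, IsHom f →
    ∀ x, barD n N (iterMap n f x) = iterMap (n + 1) f (barD n M x) := by
  induction n with
  | zero =>
    intro M N f hf x
    have h1 := LinearMap.congr_fun (coindMap_comp_unit hf) x
    have h2 := LinearMap.congr_fun (coindMap_comp_central hf) x
    exact (congrArg₂ (· - ·) h1.symm h2.symm).trans (map_sub (coindMap f) _ _).symm
  | succ n ih =>
    intro M N f hf x
    rw [barD_succ_apply, barD_succ_apply, map_sub]
    congr 1
    · rw [← LinearMap.comp_apply, ← iterMap_comp, ← coindMap_comp_unit hf, iterMap_comp]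
      rfl
    · exact ih hf.coindMap x

theorem barD_central (M : GradedBimodule 𝒜) (x : M) : barD 0 M.coind (M.central x) = 0 := by
  refine coind_ext fun z => coind_ext fun y => ?_
  change M.r (y * z) x - M.r z (M.r y x) = 0
  rw [mul_comm, map_mul, Module.End.mul_apply, sub_self]

theorem barD_barD (n : ℕ) : ∀ (M : GradedBimodule 𝒜) x, barD (n + 1) M (barD n M x) = 0 := by
  induction n with
  | zero =>
    intro M x
    rw [barD_succ_apply, ← barD_map 0 isHom_unit]
    change barD 0 M.coind (M.unit x) - barD 0 M.coind (M.unit x - M.central x) = 0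
    rw [map_sub, barD_central, sub_zero, sub_self]
  | succ n ih =>
    intro M x
    rw [barD_succ_apply, ← barD_map _ isHom_unit, barD_succ_apply n]
    erw [map_sub, ih]
    exact (congrArg _ (sub_zero _)).trans (sub_self _)

theorem barD_mem (n : ℕ) : ∀ {M : GradedBimodule 𝒜} {w x}, x ∈ (iterCoind n M).W w →
    barD n M x ∈ (iterCoind (n + 1) M).W w := by
  induction n with
  | zero => exact fun h => sub_mem (isHomogeneous_unit h) (isHomogeneous_central h)
  | succ n ih => exact fun h => sub_mem (iterMap_mem (n + 1) isHomogeneous_unit h) (ih h)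

end GradedBimodule

/-- The Hochschild cochain complex with coefficients in a bimodule. -/
def barComplex {k A : Type u} [Field k] [CommRing A] [Algebra k A] (𝒜 : ℤ → Submodule k A)
    [SetLike.GradedMonoid 𝒜] : NaturalComplex 𝒜 where
  X n M := iterCoind n M
  W n M := (iterCoind n M).W
  map n _ _ f := iterMap n f
  map_id := iterMap_id
  map_comp := iterMap_comp
  map_mem n _ _ _ hf _ _ hx := iterMap_mem n hf hx
  zeroEquiv _ := LinearEquiv.refl k _
  zeroEquiv_map _ _ := rfl
  zeroEquiv_mem := Iff.rfl
  d := barD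
  d_d := barD_barD
  d_map := barD_map
  d_mem := barD_mem
  -- With this choice the contraction identity is the recursion defining `barD`.
  h _ _ := LinearMap.id
  h_map _ _ _ _ _ _ := rfl
  h_mem _ _ _ _ hx := hx
  h_d_zero _ _ := rfl
  d_central := barD_central
  h_d_add _ _ _ := sub_add_cancel _ _

/-! ### Iterated coinduction as multilinear cochains -/

namespace GradedBimodule

variable {k A : Type u} [Field k] [CommRing A] [Algebra k A] {𝒜 : ℤ → Submodule k A}
  [SetLike.GradedMonoid 𝒜]

/-- Cochains with values in the coinduced bimodule are cochains in one more variable. -/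
def uncurryCoind (n : ℕ) (M : GradedBimodule 𝒜) :
    MultilinearMap k (fun _ : Fin n => A) M.coind ≃ₗ[k]
      MultilinearMap k (fun _ : Fin (n + 1) => A) M where
  toFun g := MultilinearMap.mk' (fun x => g (Fin.tail x) (x 0))
    (by
      intro x p u v
      induction p using Fin.cases with
      | zero =>
        simp only [Fin.tail_update_zero, Function.update_self]
        exact map_add (coindEquiv M (g (Fin.tail x))) u v
      | succ q =>
        have h (w : A) : Function.update x q.succ w 0 = x 0 :=
          Function.update_of_ne (Fin.succ_ne_zero q).symm _ _
        simp [Fin.tail_update_succ, h, coind_add_apply])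
    (by
      intro x p c u
      induction p using Fin.cases with
      | zero =>
        simp only [Fin.tail_update_zero, Function.update_self]
        exact map_smul (coindEquiv M (g (Fin.tail x))) c u
      | succ q =>
        have h (w : A) : Function.update x q.succ w 0 = x 0 :=
          Function.update_of_ne (Fin.succ_ne_zero q).symm _ _
        simp [Fin.tail_update_succ, h, coind_smul_apply])
  map_add' _ _ := rfl
  map_smul' _ _ := rfl
  invFun F := MultilinearMap.mk' (fun x => (coindEquiv M).symm
      { toFun z := F (Fin.cons z x)
        map_add' u v := F.cons_add x u v
        map_smul' c u := F.cons_smul x c u })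
    (by
      intro x p u v
      ext z
      simp only [coindEquiv_symm_apply, coind_add_apply]
      change F _ = F _ + F _
      rw [Fin.cons_update, Fin.cons_update, Fin.cons_update, F.map_update_add])
    (by
      intro x p c u
      ext z
      simp only [coindEquiv_symm_apply, coind_smul_apply]
      change F _ = c • F _
      rw [Fin.cons_update, Fin.cons_update, F.map_update_smul])
  left_inv g := by
    ext x z
    change g (Fin.tail (Fin.cons z x : Fin (n + 1) → A)) ((Fin.cons z x : Fin (n + 1) → A) 0) = g x z
    rw [Fin.tail_cons, Fin.cons_zero]
  right_inv F := by
    ext x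
    change F (Fin.cons (x 0) (Fin.tail x)) = F x
    rw [Fin.cons_self_tail]

/-- Elements of the iterated coinduced bimodule as multilinear maps. -/
def cochainEquiv : ∀ (n : ℕ) (M : GradedBimodule 𝒜),
    iterCoind n M ≃ₗ[k] MultilinearMap k (fun _ : Fin n => A) M
  | 0, _ => MultilinearMap.constLinearEquivOfIsEmpty k k _ _
  | n + 1, M => (cochainEquiv n M.coind).trans (uncurryCoind n M)

theorem cochainEquiv_zero (M : GradedBimodule 𝒜) (f : iterCoind 0 M) (x : Fin 0 → A) :
    cochainEquiv 0 M f x = f := rfl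

theorem cochainEquiv_succ (n : ℕ) (M : GradedBimodule 𝒜) (f : iterCoind (n + 1) M)
    (x : Fin (n + 1) → A) :
    cochainEquiv (n + 1) M f x = cochainEquiv n M.coind f (Fin.tail x) (x 0) := rfl

theorem cochainEquiv_iterMap (n : ℕ) : ∀ {M N : GradedBimodule 𝒜} (φ : M →ₗ[k] N)
    (f : iterCoind n M) (x : Fin n → A),
    cochainEquiv n N (iterMap n φ f) x = φ (cochainEquiv n M f x) := by
  induction n with
  | zero => exact fun _ _ _ => rfl
  | succ n ih =>
    intro M N φ f x
    rw [cochainEquiv_succ, cochainEquiv_succ]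
    exact congrArg (fun g : N.coind => g (x 0)) (ih (coindMap φ) f (Fin.tail x))

theorem coind_sum_apply {M : GradedBimodule 𝒜} {ι : Type*} (s : Finset ι) (g : ι → M.coind)
    (z : A) : (∑ i ∈ s, g i) z = ∑ i ∈ s, g i z :=
  map_sum ((LinearMap.applyₗ z : (A →ₗ[k] M) →ₗ[k] M) : M.coind →ₗ[k] M) g s

/-- In the inductive step, the left-action term of the lower differential becomes the inner term `j
= 0`, and its inner terms move from `j` to `j + 1`. The minus sign in `barD` accounts for the change
of parity. -/
theorem cochainEquiv_barD (n : ℕ) : ∀ (M : GradedBimodule 𝒜) (f : iterCoind n M)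
    (x : Fin (n + 1) → A), cochainEquiv (n + 1) M (barD n M f) x =
      M.l (x 0) (cochainEquiv n M f (Fin.tail x)) +
        ∑ j : Fin n, (-1 : k) ^ ((j : ℕ) + 1) •
          cochainEquiv n M f (Fin.contractNth j.castSucc (· * ·) x) +
        (-1 : k) ^ (n + 1) • M.r (x (Fin.last n)) (cochainEquiv n M f (Fin.init x)) := by
  induction n with
  | zero =>
    intro M f x
    simp only [Finset.univ_eq_empty, Finset.sum_empty]
    change M.l (x 0) f - M.r (x 0) f = M.l (x 0) f + 0 + (-1 : k) ^ (0 + 1) • M.r (x 0) f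
    simp [sub_eq_add_neg]
  | succ n ih =>
    intro M f x
    have h : cochainEquiv (n + 2) M (barD (n + 1) M f) x =
        cochainEquiv (n + 1) M.coind (iterMap (n + 1) M.unit f) (Fin.tail x) (x 0) -
          cochainEquiv (n + 1) M.coind (barD n M.coind f) (Fin.tail x) (x 0) := by
      rw [barD_succ_apply, map_sub]
      rfl
    rw [h, ih]
    have h1 : cochainEquiv (n + 1) M.coind (iterMap (n + 1) M.unit f) (Fin.tail x) (x 0) =
        M.l (x 0) (cochainEquiv (n + 1) M f (Fin.tail x)) :=
      congrArg (fun g : M.coind => g (x 0)) (cochainEquiv_iterMap (n + 1) M.unit f (Fin.tail x))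
    rw [h1, coind_add_apply, coind_add_apply, coind_sum_apply, coind_l_apply, coind_smul_apply,
      coind_r_apply, Fin.sum_univ_succ]
    simp only [coind_smul_apply, cochainEquiv_succ n, tail_contractNth_zero,
      tail_contractNth_succ, contractNth_zero_apply_zero, contractNth_succ_apply_zero,
      Fin.tail_init_eq_init_tail, Fin.val_succ, Fin.val_zero, pow_succ _ (_ + 1), neg_smul, mul_neg,
      mul_one, Finset.sum_neg_distrib, zero_add, pow_one, one_smul]
    have e1 : x (Fin.last (n + 1)) = Fin.tail x (Fin.last n) := rfl
    have e2 : Fin.init x 0 = x 0 := rfl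
    have e3 : Fin.tail x 0 = x (Fin.succ 0) := rfl
    rw [e1, e2, e3]
    abel

theorem cochainEquiv_mem (n : ℕ) : ∀ {M : GradedBimodule 𝒜} {f : iterCoind n M} {w : ℤ},
    f ∈ (iterCoind n M).W w ↔ ∀ (d : Fin n → ℤ) (x : Fin n → A), (∀ i, x i ∈ 𝒜 (d i)) →
      cochainEquiv n M f x ∈ M.W (∑ i, d i + w) := by
  induction n with
  | zero =>
    intro M f w
    refine ⟨fun h d x _ => ?_, fun h => ?_⟩
    · rw [cochainEquiv_zero]
      simpa using h
    · have := h 0 0 (fun i => i.elim0)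
      rw [cochainEquiv_zero] at this
      simpa using this
  | succ n ih =>
    intro M f w
    refine (ih (M := M.coind)).trans ⟨fun h d x hx => ?_, fun h d x hx e z hz => ?_⟩
    · have := h (Fin.tail d) (Fin.tail x) (fun i => hx i.succ) (d 0) (x 0) (hx 0)
      have e : d 0 + ∑ i : Fin n, d i.succ + w = ∑ i, Fin.tail d i + w + d 0 := by
        simp only [Fin.tail]
        ring
      rw [Fin.sum_univ_succ, e]
      exact this
    · have := h (Fin.cons e d) (Fin.cons z x) (Fin.cases hz hx)
      rw [Fin.sum_univ_succ, cochainEquiv_succ] at this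
      simp only [Fin.cons_zero, Fin.cons_succ, Fin.tail_cons] at this
      rw [show e + ∑ i, d i + w = ∑ i, d i + w + e by ring] at this
      exact this

end GradedBimodule

/-! ### Identification with the Hochschild complex of the algebra -/

namespace GradedBimodule

variable {k A : Type u} [Field k] [CommRing A] [Algebra k A] (𝒜 : ℤ → Submodule k A)
  [SetLike.GradedMonoid 𝒜]

/-- The bar complex with coefficients in `A` is the complex of Hochschild cochains. -/
def hochschildEquiv (n : ℕ) : iterCoind n (regular 𝒜) ≃ₗ[k] HochschildCochain k A n :=
  cochainEquiv n (regular 𝒜)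

theorem hochschildEquiv_barD (n : ℕ) (f : iterCoind n (regular 𝒜)) :
    hochschildEquiv 𝒜 (n + 1) (barD n (regular 𝒜) f) =
      hochschildDifferential k A n (hochschildEquiv 𝒜 n f) := by
  ext x
  refine (cochainEquiv_barD n (regular 𝒜) f x).trans ?_
  simp only [hochschildDifferential, LinearMap.coe_mk, AddHom.coe_mk, HochschildCochain.add_apply,
    HochschildCochain.sum_apply, HochschildCochain.smul_apply, HochschildCochain.head_apply,
    HochschildCochain.inner_apply, HochschildCochain.last_apply,
    mul_comm _ (x (Fin.last n))]
  rfl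

theorem hochschildEquiv_mem {n : ℕ} {f : iterCoind n (regular 𝒜)} {w : ℤ} :
    hochschildEquiv 𝒜 n f ∈ weightCochains 𝒜 n w ↔ f ∈ (iterCoind n (regular 𝒜)).W w :=
  (cochainEquiv_mem n (M := regular 𝒜)).symm

theorem hochschildEquiv_mem_cocycles {n : ℕ} {f : iterCoind n (regular 𝒜)} :
    hochschildEquiv 𝒜 n f ∈ hochschildCocycles k A n ↔ barD n (regular 𝒜) f = 0 := by
  rw [hochschildCocycles, LinearMap.mem_ker, ← hochschildEquiv_barD, LinearEquiv.map_eq_zero_iff]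

theorem hochschildEquiv_mem_coboundaries {n : ℕ} {f : iterCoind n (regular 𝒜)} :
    hochschildEquiv 𝒜 n f ∈ hochschildCoboundaries k A n ↔
      (barComplex 𝒜).IsCoboundary n (M := regular 𝒜) f := by
  cases n with
  | zero =>
    exact (Submodule.mem_bot k).trans (LinearEquiv.map_eq_zero_iff _)
  | succ n =>
    refine LinearMap.mem_range.trans ⟨fun ⟨g, hg⟩ => ?_, fun ⟨g, hg⟩ => ?_⟩
    · refine ⟨(hochschildEquiv 𝒜 n).symm g, (hochschildEquiv 𝒜 (n + 1)).injective ?_⟩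
      rw [← hg]
      refine (hochschildEquiv_barD 𝒜 n _).trans ?_
      rw [LinearEquiv.apply_symm_apply]
    · exact ⟨hochschildEquiv 𝒜 n g, (hochschildEquiv_barD 𝒜 n g).symm.trans (congrArg _ hg)⟩

end GradedBimodule

/-! ### Plane curves `x ^ b = y ^ a` and their matrix factorization -/

/-- A graded algebra generated by homogeneous elements `x`, `y` with `x ^ b = y ^ a`, having the
monomials `x ^ i * y ^ j`, `j < a`, as a basis. -/
structure QuasiHomogeneousCurve {k A : Type u} [Field k] [CommRing A] [Algebra k A]
    (𝒜 : ℤ → Submodule k A) where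
  a : ℕ
  b : ℕ
  a_pos : 0 < a
  x : A
  y : A
  α : ℤ
  β : ℤ
  x_mem : x ∈ 𝒜 α
  y_mem : y ∈ 𝒜 β
  rel : x ^ b = y ^ a
  weight_rel : b * α = a * β
  basis : Module.Basis (ℕ × Fin a) k A
  basis_apply : ∀ i, basis i = x ^ i.1 * y ^ (i.2 : ℕ)
  repr_weight : ∀ {e z i}, z ∈ 𝒜 e → basis.repr z i ≠ 0 → i.1 * α + (i.2 : ℕ) * β = e

namespace QuasiHomogeneousCurve

variable {k A : Type u} [Field k] [CommRing A] [Algebra k A] {𝒜 : ℤ → Submodule k A}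
  (C : QuasiHomogeneousCurve 𝒜)

section operators

variable (M : GradedBimodule 𝒜)

/-- The difference of the two actions of `x`. -/
def ξ : Module.End k M := M.l C.x - M.r C.x

/-- The difference of the two actions of `y`. -/
def η : Module.End k M := M.l C.y - M.r C.y

/-- The divided difference of `x ^ b`. -/
def Δx : Module.End k M := ∑ i ∈ Finset.range C.b, M.l C.x ^ i * M.r C.x ^ (C.b - 1 - i)

/-- The divided difference of `-y ^ a`. -/
def Δy : Module.End k M := -∑ i ∈ Finset.range C.a, M.l C.y ^ i * M.r C.y ^ (C.a - 1 - i)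

variable {M}

theorem ξ_apply (m : M) : C.ξ M m = M.l C.x m - M.r C.x m := rfl

theorem η_apply (m : M) : C.η M m = M.l C.y m - M.r C.y m := rfl

theorem Δx_apply (m : M) : C.Δx M m =
    ∑ i ∈ Finset.range C.b, M.l (C.x ^ i) (M.r (C.x ^ (C.b - 1 - i)) m) := by
  simp [Δx, LinearMap.sum_apply]

theorem Δy_apply (m : M) : C.Δy M m =
    -∑ i ∈ Finset.range C.a, M.l (C.y ^ i) (M.r (C.y ^ (C.a - 1 - i)) m) := by
  simp [Δy, LinearMap.sum_apply]

theorem commute_l_r (z z' : A) : Commute (M.l z) (M.r z') :=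
  LinearMap.ext fun m => M.l_r z z' m

theorem commute_l_l (z z' : A) : Commute (M.l z) (M.l z') := (Commute.all z z').map M.l

theorem commute_r_r (z z' : A) : Commute (M.r z) (M.r z') := (Commute.all z z').map M.r

theorem commute_ξ_η : Commute (C.ξ M) (C.η M) :=
  Commute.sub_left (Commute.sub_right (commute_l_l C.x C.y) (commute_l_r C.x C.y))
    (Commute.sub_right (commute_l_r C.y C.x).symm (commute_r_r C.x C.y))

theorem commute_Δx {f : Module.End k M} (hl : Commute f (M.l C.x)) (hr : Commute f (M.r C.x)) :
    Commute f (C.Δx M) :=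
  Commute.sum_right _ _ _ fun _ _ => (hl.pow_right _).mul_right (hr.pow_right _)

theorem commute_Δy {f : Module.End k M} (hl : Commute f (M.l C.y)) (hr : Commute f (M.r C.y)) :
    Commute f (C.Δy M) :=
  (Commute.sum_right _ _ _ fun _ _ => (hl.pow_right _).mul_right (hr.pow_right _)).neg_right

theorem commute_ξ_Δx : Commute (C.ξ M) (C.Δx M) :=
  C.commute_Δx ((commute_l_l _ _).sub_left (commute_l_r _ _).symm)
    ((commute_l_r _ _).sub_left (commute_r_r _ _))

theorem commute_ξ_Δy : Commute (C.ξ M) (C.Δy M) :=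
  C.commute_Δy ((commute_l_l _ _).sub_left (commute_l_r _ _).symm)
    ((commute_l_r _ _).sub_left (commute_r_r _ _))

theorem commute_η_Δx : Commute (C.η M) (C.Δx M) :=
  C.commute_Δx ((commute_l_l _ _).sub_left (commute_l_r _ _).symm)
    ((commute_l_r _ _).sub_left (commute_r_r _ _))

theorem commute_η_Δy : Commute (C.η M) (C.Δy M) :=
  C.commute_Δy ((commute_l_l _ _).sub_left (commute_l_r _ _).symm)
    ((commute_l_r _ _).sub_left (commute_r_r _ _))

/-- Both products telescope, to the differences of the two actions of `x^b` and of `-y^a`; these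
cancel by the relation. This is the only place where the relation enters the square of the periodic
differential. -/
theorem Δx_mul_ξ_add : C.Δx M * C.ξ M + C.Δy M * C.η M = 0 := by
  rw [Δx, Δy, ξ, η, (commute_l_r _ _).geom_sum₂_mul, neg_mul, (commute_l_r _ _).geom_sum₂_mul,
    ← map_pow, ← map_pow, ← map_pow, ← map_pow, C.rel, add_neg_cancel]

theorem ξ_Δx_add (m : M) : C.ξ M (C.Δx M m) + C.η M (C.Δy M m) = 0 := by
  have := LinearMap.congr_fun (C.Δx_mul_ξ_add (M := M)) m
  rwa [← C.commute_ξ_Δx.eq, ← C.commute_η_Δy.eq] at this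

theorem ξ_η (m : M) : C.ξ M (C.η M m) = C.η M (C.ξ M m) := LinearMap.congr_fun C.commute_ξ_η.eq m

theorem ξ_Δx (m : M) : C.ξ M (C.Δx M m) = C.Δx M (C.ξ M m) :=
  LinearMap.congr_fun C.commute_ξ_Δx.eq m

theorem ξ_Δy (m : M) : C.ξ M (C.Δy M m) = C.Δy M (C.ξ M m) :=
  LinearMap.congr_fun C.commute_ξ_Δy.eq m

theorem η_Δx (m : M) : C.η M (C.Δx M m) = C.Δx M (C.η M m) :=
  LinearMap.congr_fun C.commute_η_Δx.eq m

theorem η_Δy (m : M) : C.η M (C.Δy M m) = C.Δy M (C.η M m) :=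
  LinearMap.congr_fun C.commute_η_Δy.eq m

theorem _root_.GradedBimodule.IsHom.map_ξ {N : GradedBimodule 𝒜} {f : M →ₗ[k] N} (hf : IsHom f)
    (m : M) : f (C.ξ M m) = C.ξ N (f m) := by
  rw [ξ_apply, ξ_apply, map_sub, hf.map_l, hf.map_r]

theorem _root_.GradedBimodule.IsHom.map_η {N : GradedBimodule 𝒜} {f : M →ₗ[k] N} (hf : IsHom f)
    (m : M) : f (C.η M m) = C.η N (f m) := by
  rw [η_apply, η_apply, map_sub, hf.map_l, hf.map_r]

theorem _root_.GradedBimodule.IsHom.map_Δx {N : GradedBimodule 𝒜} {f : M →ₗ[k] N} (hf : IsHom f)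
    (m : M) : f (C.Δx M m) = C.Δx N (f m) := by
  simp only [Δx_apply, map_sum, hf.map_l, hf.map_r]

theorem _root_.GradedBimodule.IsHom.map_Δy {N : GradedBimodule 𝒜} {f : M →ₗ[k] N} (hf : IsHom f)
    (m : M) : f (C.Δy M m) = C.Δy N (f m) := by
  simp only [Δy_apply, map_neg, map_sum, hf.map_l, hf.map_r]

theorem ξ_mem {w : ℤ} {m : M} (hm : m ∈ M.W w) : C.ξ M m ∈ M.W (w + C.α) :=
  sub_mem (M.l_mem C.x_mem hm) (M.r_mem C.x_mem hm)

theorem η_mem {w : ℤ} {m : M} (hm : m ∈ M.W w) : C.η M m ∈ M.W (w + C.β) :=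
  sub_mem (M.l_mem C.y_mem hm) (M.r_mem C.y_mem hm)

variable [SetLike.GradedMonoid 𝒜]

theorem x_pow_mem (i : ℕ) : C.x ^ i ∈ 𝒜 (i * C.α) := by
  simpa using SetLike.pow_mem_graded i C.x_mem

theorem y_pow_mem (i : ℕ) : C.y ^ i ∈ 𝒜 (i * C.β) := by
  simpa using SetLike.pow_mem_graded i C.y_mem

theorem Δx_mem {w : ℤ} {m : M} (hm : m ∈ M.W w) : C.Δx M m ∈ M.W (w + (C.b * C.α - C.α)) := by
  rw [Δx_apply]
  refine sum_mem fun i hi => ?_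
  have := M.l_mem (C.x_pow_mem i) (M.r_mem (C.x_pow_mem (C.b - 1 - i)) hm)
  rw [Finset.mem_range] at hi
  rwa [show w + ((C.b - 1 - i : ℕ) : ℤ) * C.α + i * C.α = w + (C.b * C.α - C.α) by
    rw [show ((C.b - 1 - i : ℕ) : ℤ) = C.b - 1 - i by omega]; ring] at this

theorem Δy_mem {w : ℤ} {m : M} (hm : m ∈ M.W w) : C.Δy M m ∈ M.W (w + (C.a * C.β - C.β)) := by
  rw [Δy_apply]
  refine neg_mem (sum_mem fun i hi => ?_)
  have := M.l_mem (C.y_pow_mem i) (M.r_mem (C.y_pow_mem (C.a - 1 - i)) hm)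
  rw [Finset.mem_range] at hi
  rwa [show w + ((C.a - 1 - i : ℕ) : ℤ) * C.β + i * C.β = w + (C.a * C.β - C.β) by
    rw [show ((C.a - 1 - i : ℕ) : ℤ) = C.a - 1 - i by omega]; ring] at this

end operators

/-! #### Contracting operators on coinduced bimodules -/

section contraction

variable [SetLike.GradedMonoid 𝒜] {M : GradedBimodule 𝒜}

/-- Evaluation of an element of the coinduced bimodule. -/
def _root_.GradedBimodule.evAt (M : GradedBimodule 𝒜) (z : A) : M.coind →ₗ[k] M :=
  (LinearMap.applyₗ z : (A →ₗ[k] M) →ₗ[k] M)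

theorem evAt_apply (z : A) (g : M.coind) : M.evAt z g = g z := rfl

theorem coind_ext_monomial {g g' : M.coind}
    (h : ∀ i j, j < C.a → g (C.x ^ i * C.y ^ j) = g' (C.x ^ i * C.y ^ j)) : g = g' :=
  (coindEquiv M).injective <| C.basis.ext fun i => by
    rw [C.basis_apply, coindEquiv_apply, coindEquiv_apply, h _ _ i.2.2]

/-- The element of the coinduced bimodule with prescribed values on the basis. -/
def ofValues (M : GradedBimodule 𝒜) : (ℕ × Fin C.a → M) →ₗ[k] M.coind :=
  (coindEquiv M).symm.toLinearMap ∘ₗ (C.basis.constr k).toLinearMap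

theorem ofValues_apply (c : ℕ × Fin C.a → M) (i : ℕ) {j : ℕ} (hj : j < C.a) :
    C.ofValues M c (C.x ^ i * C.y ^ j) = c (i, ⟨j, hj⟩) := by
  have := C.basis.constr_basis k c (i, ⟨j, hj⟩)
  rw [C.basis_apply] at this
  exact this

theorem ofValues_mem {c : ℕ × Fin C.a → M} {w : ℤ}
    (hc : ∀ i, c i ∈ M.W (w + (i.1 * C.α + (i.2 : ℕ) * C.β))) : C.ofValues M c ∈ M.coind.W w := by
  refine mem_coind_W.2 fun e z hz => ?_
  have : C.ofValues M c z = _ := C.basis.constr_apply k c z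
  rw [this]
  refine sum_mem fun i hi => Submodule.smul_mem _ _ ?_
  rw [← C.repr_weight hz (Finsupp.mem_support_iff.1 hi)]
  exact hc i

/-- A right inverse of `ξ`. -/
def opK (M : GradedBimodule 𝒜) : M.coind →ₗ[k] M.coind :=
  C.ofValues M ∘ₗ LinearMap.pi fun i =>
    ∑ l ∈ Finset.range i.1, M.r (C.x ^ (i.1 - 1 - l)) ∘ₗ M.evAt (C.x ^ l * C.y ^ (i.2 : ℕ))

/-- A contraction of `η` on the kernel of `ξ`. -/
def opL (M : GradedBimodule 𝒜) : M.coind →ₗ[k] M.coind :=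
  C.ofValues M ∘ₗ LinearMap.pi fun i => M.r (C.x ^ i.1) ∘ₗ
    ∑ l ∈ Finset.range (i.2 : ℕ), M.r (C.y ^ ((i.2 : ℕ) - 1 - l)) ∘ₗ M.evAt (C.y ^ l)

/-- A contraction of `Δy` on the kernel of `ξ`. -/
def opN (M : GradedBimodule 𝒜) : M.coind →ₗ[k] M.coind :=
  C.ofValues M ∘ₗ LinearMap.pi fun i => M.r (C.x ^ i.1) ∘ₗ
    if (i.2 : ℕ) + 1 = C.a then -M.ev else 0

theorem opK_apply (g : M.coind) (i : ℕ) {j : ℕ} (hj : j < C.a) :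
    C.opK M g (C.x ^ i * C.y ^ j) =
      ∑ l ∈ Finset.range i, M.r (C.x ^ (i - 1 - l)) (g (C.x ^ l * C.y ^ j)) := by
  rw [opK, LinearMap.comp_apply, ofValues_apply _ _ _ hj]
  simp [LinearMap.sum_apply, evAt_apply]

theorem opL_apply (g : M.coind) (i : ℕ) {j : ℕ} (hj : j < C.a) :
    C.opL M g (C.x ^ i * C.y ^ j) =
      M.r (C.x ^ i) (∑ l ∈ Finset.range j, M.r (C.y ^ (j - 1 - l)) (g (C.y ^ l))) := by
  rw [opL, LinearMap.comp_apply, ofValues_apply _ _ _ hj]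
  simp [evAt_apply]

theorem opN_apply (g : M.coind) (i : ℕ) {j : ℕ} (hj : j < C.a) :
    C.opN M g (C.x ^ i * C.y ^ j) = M.r (C.x ^ i) (if j + 1 = C.a then -g 1 else 0) := by
  rw [opN, LinearMap.comp_apply, ofValues_apply _ _ _ hj]
  simp only [LinearMap.pi_apply, LinearMap.comp_apply]
  split_ifs <;> rfl

theorem opL_apply_y (g : M.coind) {j : ℕ} (hj : j < C.a) :
    C.opL M g (C.y ^ j) = ∑ l ∈ Finset.range j, M.r (C.y ^ (j - 1 - l)) (g (C.y ^ l)) := by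
  simpa using C.opL_apply g 0 hj

theorem opN_apply_y (g : M.coind) {j : ℕ} (hj : j < C.a) :
    C.opN M g (C.y ^ j) = if j + 1 = C.a then -g 1 else 0 := by
  simpa using C.opN_apply g 0 hj

theorem coind_ξ_apply (g : M.coind) (z : A) :
    C.ξ M.coind g z = g (z * C.x) - M.r C.x (g z) := rfl

theorem coind_η_apply (g : M.coind) (z : A) :
    C.η M.coind g z = g (z * C.y) - M.r C.y (g z) := rfl

theorem coind_Δy_apply (g : M.coind) (z : A) : C.Δy M.coind g z =
    -∑ i ∈ Finset.range C.a, M.r (C.y ^ (C.a - 1 - i)) (g (z * C.y ^ i)) := by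
  rw [Δy_apply]
  have h := (map_neg (M.evAt z) (∑ i ∈ Finset.range C.a,
    M.coind.l (C.y ^ i) (M.coind.r (C.y ^ (C.a - 1 - i)) g))).trans (congrArg _ (map_sum _ _ _))
  exact h

omit [SetLike.GradedMonoid 𝒜] in
theorem sum_range_succ_r_pow (z : A) (g : ℕ → M) (n : ℕ) :
    ∑ l ∈ Finset.range (n + 1), M.r (z ^ (n - l)) (g l) =
      M.r z (∑ l ∈ Finset.range n, M.r (z ^ (n - 1 - l)) (g l)) + g n := by
  rw [Finset.sum_range_succ, map_sum, Nat.sub_self, pow_zero, map_one, Module.End.one_apply]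
  congr 1
  refine Finset.sum_congr rfl fun l hl => ?_
  rw [Finset.mem_range] at hl
  rw [← Module.End.mul_apply, ← map_mul, ← pow_succ', show n - 1 - l + 1 = n - l by omega]

omit [SetLike.GradedMonoid 𝒜] in
/-- Telescoping of a geometric sum of differences. -/
theorem sum_range_r_pow_sub (z : A) (g : ℕ → M) (n : ℕ) :
    ∑ l ∈ Finset.range n, M.r (z ^ (n - 1 - l)) (g (l + 1) - M.r z (g l)) =
      g n - M.r (z ^ n) (g 0) := by
  induction n with
  | zero => simp
  | succ n ih =>
    rw [Nat.add_sub_cancel, sum_range_succ_r_pow z (fun l => g (l + 1) - M.r z (g l)), ih, map_sub,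
      ← Module.End.mul_apply, ← map_mul, ← pow_succ']
    abel

/-- Here `ξ g' = g` reads `g'(z x) = g'(z) x + g(z)`, a recursion in the exponent of `x`; `opK` is
its solution with value 0 at the powers `y^j`, `j < a`. -/
theorem ξ_opK (g : M.coind) : C.ξ M.coind (C.opK M g) = g := by
  refine C.coind_ext_monomial fun i j hj => ?_
  rw [coind_ξ_apply, show C.x ^ i * C.y ^ j * C.x = C.x ^ (i + 1) * C.y ^ j by ring,
    C.opK_apply _ _ hj, C.opK_apply _ _ hj, Nat.add_sub_cancel,
    sum_range_succ_r_pow C.x (fun l => g (C.x ^ l * C.y ^ j)), add_sub_cancel_left]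

theorem opK_ξ_apply (g : M.coind) (i : ℕ) {j : ℕ} (hj : j < C.a) :
    C.opK M (C.ξ M.coind g) (C.x ^ i * C.y ^ j) =
      g (C.x ^ i * C.y ^ j) - M.r (C.x ^ i) (g (C.y ^ j)) := by
  rw [C.opK_apply _ _ hj]
  have := sum_range_r_pow_sub C.x (fun l => g (C.x ^ l * C.y ^ j)) i
  simp only [pow_zero, one_mul] at this
  rw [← this]
  refine Finset.sum_congr rfl fun l _ => ?_
  rw [coind_ξ_apply, show C.x ^ l * C.y ^ j * C.x = C.x ^ (l + 1) * C.y ^ j by ring]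

theorem ξ_opL (g : M.coind) : C.ξ M.coind (C.opL M g) = 0 := by
  refine C.coind_ext_monomial fun i j hj => ?_
  rw [coind_ξ_apply, show C.x ^ i * C.y ^ j * C.x = C.x ^ (i + 1) * C.y ^ j by ring,
    C.opL_apply _ _ hj, C.opL_apply _ _ hj, pow_succ', map_mul, Module.End.mul_apply, sub_self]
  rfl

theorem ξ_opN (g : M.coind) : C.ξ M.coind (C.opN M g) = 0 := by
  refine C.coind_ext_monomial fun i j hj => ?_
  rw [coind_ξ_apply, show C.x ^ i * C.y ^ j * C.x = C.x ^ (i + 1) * C.y ^ j by ring,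
    C.opN_apply _ _ hj, C.opN_apply _ _ hj, pow_succ', map_mul, Module.End.mul_apply, sub_self]
  rfl

/-- The kernel of `ξ` consists of the maps linear over `k[x]` for the right action. As `A` is free
over `k[x]` on the `y^j` with `j < a`, all identities on this kernel reduce to values on those
powers. -/
theorem apply_x_pow_mul {g : M.coind} (hg : C.ξ M.coind g = 0) (i : ℕ) (z : A) :
    g (C.x ^ i * z) = M.r (C.x ^ i) (g z) := by
  induction i with
  | zero => simp
  | succ i ih =>
    have h : C.ξ M.coind g (C.x ^ i * z) = 0 := by rw [hg]; rfl
    rw [coind_ξ_apply, sub_eq_zero] at h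
    rw [show C.x ^ (i + 1) * z = C.x ^ i * z * C.x by ring, h, ih, pow_succ', map_mul,
      Module.End.mul_apply]

/-- Elements killed by `ξ` are determined by their values on the powers of `y`. -/
theorem ext_of_ξ_eq_zero {g g' : M.coind} (hg : C.ξ M.coind g = 0) (hg' : C.ξ M.coind g' = 0)
    (h : ∀ j < C.a, g (C.y ^ j) = g' (C.y ^ j)) : g = g' :=
  C.coind_ext_monomial fun i j hj => by
    rw [C.apply_x_pow_mul hg, C.apply_x_pow_mul hg', h j hj]

theorem opK_apply_y (g : M.coind) {j : ℕ} (hj : j < C.a) : C.opK M g (C.y ^ j) = 0 := by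
  simpa using C.opK_apply g 0 hj

theorem opL_opK (g : M.coind) : C.opL M (C.opK M g) = 0 :=
  C.ext_of_ξ_eq_zero (C.ξ_opL _) (map_zero _) fun j hj => by
    rw [C.opL_apply_y _ hj]
    refine Finset.sum_eq_zero fun l hl => ?_
    rw [C.opK_apply_y _ ((Finset.mem_range.1 hl).trans hj), map_zero]

theorem opN_opK (g : M.coind) : C.opN M (C.opK M g) = 0 :=
  C.ext_of_ξ_eq_zero (C.ξ_opN _) (map_zero _) fun j hj => by
    have h := C.opK_apply_y g C.a_pos
    rw [pow_zero] at h
    rw [C.opN_apply_y _ hj, h, neg_zero, ite_self]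
    rfl

theorem ξ_central (m : M) : C.ξ M.coind (M.central m) = 0 := by
  refine coind_ext fun z => ?_
  rw [coind_ξ_apply, central_apply, central_apply, mul_comm, map_mul, Module.End.mul_apply,
    sub_self]
  rfl

theorem η_central (m : M) : C.η M.coind (M.central m) = 0 := by
  refine coind_ext fun z => ?_
  rw [coind_η_apply, central_apply, central_apply, mul_comm, map_mul, Module.End.mul_apply,
    sub_self]
  rfl

/-- On the powers `y^j`, `j < a`, `opN g` is supported at `y^(a-1)`, so a single term of the divided
difference survives. -/
theorem Δy_opN (g : M.coind) : C.Δy M.coind (C.opN M g) = M.central (g 1) := by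
  refine C.ext_of_ξ_eq_zero ?_ (C.ξ_central _) fun j hj => ?_
  · rw [C.ξ_Δy, C.ξ_opN, map_zero]
  · rw [coind_Δy_apply, central_apply, Finset.sum_eq_single (C.a - 1 - j)]
    · rw [← pow_add, C.opN_apply_y _ (by omega), if_pos (by omega),
        show C.a - 1 - (C.a - 1 - j) = j by omega, map_neg, neg_neg]
    · intro i hi hij
      rw [Finset.mem_range] at hi
      rw [← pow_add]
      by_cases h : j + i < C.a
      · rw [C.opN_apply_y _ h, if_neg (by omega), map_zero]
      -- Past `y^a` the exponent wraps around through `y^a = x^b`, leaving at most `y^(a-2)`, where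
      -- `opN g` vanishes.
      · rw [show j + i = C.a + (j + i - C.a) by omega, pow_add, ← C.rel,
          C.opN_apply _ _ (by omega), if_neg (by omega), map_zero, map_zero]
    · intro h
      rw [Finset.mem_range] at h
      omega

/-- At `x^i y^j` the three terms telescope: `opN` gives the value carried over from `1`, `opL` the
difference between `y^j` and `1`, and `opK` the difference between `x^i y^j` and `y^j`. -/
theorem Δy_opN_add (g : M.coind) :
    C.Δy M.coind (C.opN M g) + C.opL M (C.η M.coind g) + C.opK M (C.ξ M.coind g) = g := by
  refine C.coind_ext_monomial fun i j hj => ?_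
  rw [coind_add_apply, coind_add_apply, C.opK_ξ_apply _ _ hj, Δy_opN, central_apply,
    C.opL_apply _ _ hj, map_mul, Module.End.mul_apply]
  have := sum_range_r_pow_sub C.y (fun l => g (C.y ^ l)) j
  simp only [pow_zero] at this
  simp only [coind_η_apply, ← pow_succ]
  rw [this, map_sub]
  abel

/-- The first two terms sum to an element of the kernel of `ξ`, so only powers of `y` need checking.
Below `y^(a-1)` the recursion for `opL` suffices; at `y^(a-1)` the `opN` term corrects it. -/
theorem η_opL_add (g : M.coind) :
    C.η M.coind (C.opL M g) + C.opN M (C.Δy M.coind g) + C.opK M (C.ξ M.coind g) = g := by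
  have h0 : C.ξ M.coind (C.η M.coind (C.opL M g) + C.opN M (C.Δy M.coind g)) = 0 := by
    rw [map_add, C.ξ_η, C.ξ_opL, C.ξ_opN, map_zero, add_zero]
  refine C.coind_ext_monomial fun i j hj => ?_
  rw [coind_add_apply, C.opK_ξ_apply _ _ hj, C.apply_x_pow_mul h0]
  have h1 : (C.η M.coind (C.opL M g) + C.opN M (C.Δy M.coind g)) (C.y ^ j) = g (C.y ^ j) := by
    rw [coind_add_apply, coind_η_apply, C.opL_apply_y _ hj, C.opN_apply_y _ hj, ← pow_succ]
    have key := sum_range_succ_r_pow C.y (fun l => g (C.y ^ l)) j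
    by_cases h : j + 1 = C.a
    -- Multiplication by `y` now gives `y^a = x^b`, where `opL g` is zero since it vanishes at `1`.
    -- The full geometric sum missing there is supplied by `Δy`.
    · rw [if_pos h, h, ← C.rel, ← mul_one (C.x ^ C.b), C.apply_x_pow_mul (C.ξ_opL g)]
      have h2 := C.opL_apply_y g C.a_pos
      rw [pow_zero, Finset.sum_range_zero] at h2
      rw [h2, map_zero, coind_Δy_apply, neg_neg]
      simp only [one_mul]
      rw [show C.a - 1 = j by omega, ← h, key]
      abel
    · rw [if_neg h, C.opL_apply_y _ (by omega), Nat.add_sub_cancel, key]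
      abel
  rw [h1, add_sub_cancel]

theorem opK_coindMap {N : GradedBimodule 𝒜} {f : M →ₗ[k] N} (hf : IsHom f) (g : M.coind) :
    C.opK N (coindMap f g) = coindMap f (C.opK M g) :=
  C.coind_ext_monomial fun i j hj => by
    simp only [coindMap_apply, C.opK_apply _ _ hj, map_sum, hf.map_r]

theorem opL_coindMap {N : GradedBimodule 𝒜} {f : M →ₗ[k] N} (hf : IsHom f) (g : M.coind) :
    C.opL N (coindMap f g) = coindMap f (C.opL M g) :=
  C.coind_ext_monomial fun i j hj => by
    simp only [coindMap_apply, C.opL_apply _ _ hj, map_sum, hf.map_r]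

theorem opN_coindMap {N : GradedBimodule 𝒜} {f : M →ₗ[k] N} (hf : IsHom f) (g : M.coind) :
    C.opN N (coindMap f g) = coindMap f (C.opN M g) :=
  C.coind_ext_monomial fun i j hj => by
    simp only [coindMap_apply, C.opN_apply _ _ hj, hf.map_r, apply_ite f, map_neg, map_zero]

theorem opK_mem {w : ℤ} {g : M.coind} (hg : g ∈ M.coind.W w) :
    C.opK M g ∈ M.coind.W (w - C.α) := by
  refine C.ofValues_mem fun i => ?_
  simp only [LinearMap.pi_apply, LinearMap.sum_apply, LinearMap.comp_apply, evAt_apply]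
  refine sum_mem fun l hl => ?_
  rw [Finset.mem_range] at hl
  have := M.r_mem (C.x_pow_mem (i.1 - 1 - l)) (hg _ _ (SetLike.mul_mem_graded (C.x_pow_mem l)
    (C.y_pow_mem i.2)))
  rw [show ((i.1 - 1 - l : ℕ) : ℤ) = i.1 - 1 - l by omega] at this
  rwa [show w - C.α + (i.1 * C.α + (i.2 : ℕ) * C.β) =
    w + (l * C.α + (i.2 : ℕ) * C.β) + (i.1 - 1 - l) * C.α by ring]

theorem opL_mem {w : ℤ} {g : M.coind} (hg : g ∈ M.coind.W w) :
    C.opL M g ∈ M.coind.W (w - C.β) := by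
  refine C.ofValues_mem fun i => ?_
  simp only [LinearMap.pi_apply, LinearMap.sum_apply, LinearMap.comp_apply, evAt_apply]
  have : ∑ l ∈ Finset.range (i.2 : ℕ), M.r (C.y ^ ((i.2 : ℕ) - 1 - l)) (g (C.y ^ l)) ∈
      M.W (w - C.β + (i.2 : ℕ) * C.β) := by
    refine sum_mem fun l hl => ?_
    rw [Finset.mem_range] at hl
    have := M.r_mem (C.y_pow_mem ((i.2 : ℕ) - 1 - l)) (hg _ _ (C.y_pow_mem l))
    rw [show (((i.2 : ℕ) - 1 - l : ℕ) : ℤ) = (i.2 : ℕ) - 1 - l by omega] at this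
    rwa [show w - C.β + (i.2 : ℕ) * C.β = w + l * C.β + ((i.2 : ℕ) - 1 - l) * C.β by ring]
  have := M.r_mem (C.x_pow_mem i.1) this
  rwa [show w - C.β + (i.1 * C.α + (i.2 : ℕ) * C.β) =
    w - C.β + (i.2 : ℕ) * C.β + i.1 * C.α by ring]

theorem opN_mem {w : ℤ} {g : M.coind} (hg : g ∈ M.coind.W w) :
    C.opN M g ∈ M.coind.W (w - (C.a * C.β - C.β)) := by
  refine C.ofValues_mem fun i => ?_
  simp only [LinearMap.pi_apply, LinearMap.comp_apply]
  split_ifs with h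
  · have := M.r_mem (C.x_pow_mem i.1) (neg_mem (isHomogeneous_ev hg))
    have ha : (C.a : ℤ) = (i.2 : ℕ) + 1 := by exact_mod_cast h.symm
    rw [ha]
    rwa [show w - (((i.2 : ℕ) + 1) * C.β - C.β) + (i.1 * C.α + (i.2 : ℕ) * C.β) =
      w + i.1 * C.α by ring]
  · rw [LinearMap.zero_apply, map_zero]
    exact zero_mem _

end contraction

end QuasiHomogeneousCurve

namespace QuasiHomogeneousCurve

variable {k A : Type u} [Field k] [CommRing A] [Algebra k A] {𝒜 : ℤ → Submodule k A}
  (C : QuasiHomogeneousCurve 𝒜)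

/-! #### The periodic complex -/

section periodic

variable (M : GradedBimodule 𝒜)

/-- The differential of the periodic complex from even to odd degrees. -/
def evenD : M × M →ₗ[k] M × M :=
  (C.ξ M ∘ₗ LinearMap.fst k M M - C.Δy M ∘ₗ LinearMap.snd k M M).prod
    (C.η M ∘ₗ LinearMap.fst k M M + C.Δx M ∘ₗ LinearMap.snd k M M)

/-- The differential of the periodic complex from odd to even degrees. -/
def oddD : M × M →ₗ[k] M × M :=
  (C.Δx M ∘ₗ LinearMap.fst k M M + C.Δy M ∘ₗ LinearMap.snd k M M).prod
    (C.ξ M ∘ₗ LinearMap.snd k M M - C.η M ∘ₗ LinearMap.fst k M M)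

variable {M}

theorem evenD_apply (p : M × M) :
    C.evenD M p = (C.ξ M p.1 - C.Δy M p.2, C.η M p.1 + C.Δx M p.2) := rfl

theorem oddD_apply (p : M × M) :
    C.oddD M p = (C.Δx M p.1 + C.Δy M p.2, C.ξ M p.2 - C.η M p.1) := rfl

theorem oddD_evenD (p : M × M) : C.oddD M (C.evenD M p) = 0 := by
  have h1 := C.ξ_Δx_add p.1
  have h2 := C.ξ_Δx_add p.2
  rw [oddD_apply, evenD_apply]
  simp only [map_sub, map_add, C.ξ_η, ← C.ξ_Δx, ← C.η_Δy]
  refine Prod.ext ?_ ?_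
  · have : C.Δy M (C.Δx M p.2) = C.Δx M (C.Δy M p.2) :=
      LinearMap.congr_fun (C.commute_Δx (C.commute_Δy (commute_l_l _ _) (commute_l_r _ _)).symm
        (C.commute_Δy (commute_l_r _ _).symm (commute_r_r _ _)).symm).eq p.2
    change C.ξ M (C.Δx M p.1) - C.Δx M (C.Δy M p.2) +
      (C.η M (C.Δy M p.1) + C.Δy M (C.Δx M p.2)) = 0
    rw [this, ← h1]
    abel
  · change C.η M (C.ξ M p.1) + C.ξ M (C.Δx M p.2) -
      (C.η M (C.ξ M p.1) - C.η M (C.Δy M p.2)) = 0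
    rw [← h2]
    abel

theorem evenD_oddD (p : M × M) : C.evenD M (C.oddD M p) = 0 := by
  have h1 := C.ξ_Δx_add p.1
  have h2 := C.ξ_Δx_add p.2
  rw [evenD_apply, oddD_apply]
  simp only [map_sub, map_add, ← C.ξ_Δx, ← C.η_Δy, ← C.ξ_Δy, ← C.η_Δx]
  refine Prod.ext ?_ ?_
  · change C.ξ M (C.Δx M p.1) + C.ξ M (C.Δy M p.2) -
      (C.ξ M (C.Δy M p.2) - C.η M (C.Δy M p.1)) = 0
    rw [← h1]
    abel
  · change C.η M (C.Δx M p.1) + C.η M (C.Δy M p.2) +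
      (C.ξ M (C.Δx M p.2) - C.η M (C.Δx M p.1)) = 0
    rw [← h2]
    abel

theorem map_evenD {N : GradedBimodule 𝒜} {f : M →ₗ[k] N} (hf : IsHom f) (p : M × M) :
    C.evenD N (f.prodMap f p) = f.prodMap f (C.evenD M p) := by
  simp only [evenD_apply, LinearMap.prodMap_apply, map_sub, map_add, hf.map_ξ, hf.map_η,
    hf.map_Δx, hf.map_Δy]

theorem map_oddD {N : GradedBimodule 𝒜} {f : M →ₗ[k] N} (hf : IsHom f) (p : M × M) :
    C.oddD N (f.prodMap f p) = f.prodMap f (C.oddD M p) := by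
  simp only [oddD_apply, LinearMap.prodMap_apply, map_sub, map_add, hf.map_ξ, hf.map_η,
    hf.map_Δx, hf.map_Δy]

variable [SetLike.GradedMonoid 𝒜]

variable (M) in
/-- The contraction from odd to even degrees; the second component vanishes. -/
def oddH : M × M →ₗ[k] M.coind :=
  (C.opK M ∘ₗ M.unit) ∘ₗ LinearMap.fst k M M + (C.opL M ∘ₗ M.unit) ∘ₗ LinearMap.snd k M M

variable (M) in
/-- The contraction from even to odd degrees; the first component vanishes. -/
def evenH : M × M →ₗ[k] M.coind :=
  (C.opK M ∘ₗ M.unit) ∘ₗ LinearMap.snd k M M + (C.opN M ∘ₗ M.unit) ∘ₗ LinearMap.fst k M M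

theorem oddH_apply (p : M × M) :
    C.oddH M p = C.opK M (M.unit p.1) + C.opL M (M.unit p.2) := rfl

theorem evenH_apply (p : M × M) :
    C.evenH M p = C.opK M (M.unit p.2) + C.opN M (M.unit p.1) := rfl

theorem oddH_map {N : GradedBimodule 𝒜} {f : M →ₗ[k] N} (hf : IsHom f) (p : M × M) :
    C.oddH N (f.prodMap f p) = coindMap f (C.oddH M p) := by
  have h (m : M) : N.unit (f m) = coindMap f (M.unit m) :=
    (LinearMap.congr_fun (coindMap_comp_unit hf) m).symm
  simp only [oddH_apply, LinearMap.prodMap_apply, h, C.opK_coindMap hf, C.opL_coindMap hf, map_add]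

theorem evenH_map {N : GradedBimodule 𝒜} {f : M →ₗ[k] N} (hf : IsHom f) (p : M × M) :
    C.evenH N (f.prodMap f p) = coindMap f (C.evenH M p) := by
  have h (m : M) : N.unit (f m) = coindMap f (M.unit m) :=
    (LinearMap.congr_fun (coindMap_comp_unit hf) m).symm
  simp only [evenH_apply, LinearMap.prodMap_apply, h, C.opK_coindMap hf, C.opN_coindMap hf, map_add]

/-- The contraction identity in odd degrees. -/
theorem even_oddH_add (p : M × M) :
    ((0 : M.coind), C.evenH M (C.oddD M p)) + C.evenD M.coind (C.oddH M p, 0) =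
      (M.unit p.1, M.unit p.2) := by
  obtain ⟨m, n⟩ := p
  simp only [evenH_apply, oddD_apply, evenD_apply, oddH_apply, map_add, map_sub,
    isHom_unit.map_ξ, isHom_unit.map_η, isHom_unit.map_Δx, isHom_unit.map_Δy, map_zero,
    sub_zero, add_zero, Prod.mk_add_mk, zero_add, C.ξ_opK, C.ξ_opL]
  refine Prod.ext rfl ?_
  set p := M.unit m
  set q := M.unit n
  have hq := C.η_opL_add q
  have hp := C.η_opL_add (C.η M.coind (C.opK M p))
  have h1 : C.opL M (C.η M.coind (C.opK M p)) = 0 := by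
    have := C.Δy_opN_add (C.opK M p)
    rw [C.opN_opK, C.ξ_opK, map_zero, zero_add] at this
    exact left_eq_add.1 (this.symm.trans (add_comm _ _))
  have h2 : C.opN M (C.Δy M.coind (C.η M.coind (C.opK M p))) = - C.opN M (C.Δx M.coind p) := by
    have := C.ξ_Δx_add (C.opK M p)
    rw [C.ξ_Δx, C.ξ_opK] at this
    rw [← C.η_Δy, ← map_neg, eq_neg_of_add_eq_zero_right this]
  -- This turns `hp` into the commutation rule `η K p = K η p - N Δx p`, where `K`, `N` are `opK`,
  -- `opN`.
  rw [h1, h2, C.ξ_η, C.ξ_opK, map_zero, zero_add] at hp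
  change C.opK M (C.ξ M.coind q) - C.opK M (C.η M.coind p) +
    (C.opN M (C.Δx M.coind p) + C.opN M (C.Δy M.coind q)) +
    (C.η M.coind (C.opK M p) + C.η M.coind (C.opL M q)) = q
  rw [← hp]
  nth_rewrite 4 [← hq]
  abel

/-- The contraction identity in positive even degrees. -/
theorem odd_evenH_add (p : M × M) :
    (C.oddH M (C.evenD M p), (0 : M.coind)) + C.oddD M.coind (0, C.evenH M p) =
      (M.unit p.1, M.unit p.2) := by
  obtain ⟨m, n⟩ := p
  simp only [evenH_apply, oddD_apply, evenD_apply, oddH_apply, map_add, map_sub,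
    isHom_unit.map_ξ, isHom_unit.map_η, isHom_unit.map_Δx, isHom_unit.map_Δy, map_zero,
    sub_zero, add_zero, Prod.mk_add_mk, zero_add, C.ξ_opK, C.ξ_opN]
  refine Prod.ext ?_ rfl
  set u := M.unit m
  set v := M.unit n
  have hu := C.Δy_opN_add u
  have hv := C.Δy_opN_add (C.Δy M.coind (C.opK M v))
  have h1 : C.opN M (C.Δy M.coind (C.opK M v)) = 0 := by
    have := C.η_opL_add (C.opK M v)
    rw [C.opL_opK, C.ξ_opK, map_zero, zero_add] at this
    exact right_eq_add.1 this.symm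
  have h2 : C.η M.coind (C.Δy M.coind (C.opK M v)) = -C.Δx M.coind v := by
    have := C.ξ_Δx_add (C.opK M v)
    rw [C.ξ_Δx, C.ξ_opK] at this
    exact eq_neg_of_add_eq_zero_right this
  -- The analogous rule: `Δy K v = K Δy v - L Δx v`, where `K`, `L` are `opK`, `opL`.
  rw [h1, h2, C.ξ_Δy, C.ξ_opK, map_zero, map_neg, zero_add] at hv
  change C.opK M (C.ξ M.coind u) - C.opK M (C.Δy M.coind v) +
    (C.opL M (C.η M.coind u) + C.opL M (C.Δx M.coind v)) +
    (C.Δy M.coind (C.opK M v) + C.Δy M.coind (C.opN M u)) = u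
  rw [← hv]
  refine Eq.trans ?_ hu
  abel

theorem oddH_evenD_zero (m : M) : C.oddH M (C.evenD M (m, 0)) = M.unit m - M.central m := by
  simp only [evenD_apply, oddH_apply, map_zero, sub_zero, add_zero, isHom_unit.map_ξ,
    isHom_unit.map_η]
  have h := C.Δy_opN_add (M.unit m)
  have h1 : M.unit m 1 = m := by rw [unit_apply, map_one]; rfl
  rw [Δy_opN, h1] at h
  rw [eq_sub_iff_add_eq]
  refine Eq.trans ?_ h
  abel

end periodic

section complex

variable [SetLike.GradedMonoid 𝒜]

/-- The terms of the periodic complex. -/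
@[reducible] def PeriodicX : ℕ → GradedBimodule 𝒜 → Type u
  | 0, M => M
  | _ + 1, M => M × M

instance : ∀ (n : ℕ) (M : GradedBimodule 𝒜), AddCommGroup (PeriodicX n M)
  | 0, M => inferInstanceAs (AddCommGroup M)
  | _ + 1, M => inferInstanceAs (AddCommGroup (M × M))

instance : ∀ (n : ℕ) (M : GradedBimodule 𝒜), Module k (PeriodicX n M)
  | 0, M => inferInstanceAs (Module k M)
  | _ + 1, M => inferInstanceAs (Module k (M × M))

/-- The shifts of the weights in degree `n + 1`. -/
def shift (n : ℕ) : ℤ × ℤ :=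
  -- The index `n` stands for degree `n + 1`. Each full period contributes the weight `aβ` of the
  -- relation; `α` and `β` belong to the Koszul generators of `x` and `y`, and `α + β` to their
  -- product.
  if Even n then (((n / 2 : ℕ) : ℤ) * (C.a * C.β) + C.α, ((n / 2 : ℕ) : ℤ) * (C.a * C.β) + C.β)
  else (((n / 2 : ℕ) : ℤ) * (C.a * C.β) + C.a * C.β, ((n / 2 : ℕ) : ℤ) * (C.a * C.β) + C.α + C.β)

/-- The weights of the periodic complex. -/
def periodicW : ∀ (n : ℕ) (M : GradedBimodule 𝒜), ℤ → Submodule k (PeriodicX n M)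
  | 0, M, w => M.W w
  | n + 1, M, w => (M.W (w + (C.shift n).1)).prod (M.W (w + (C.shift n).2))

/-- Functoriality of the periodic complex. -/
def periodicMap : ∀ (n : ℕ) {M N : GradedBimodule 𝒜}, (M →ₗ[k] N) →
    PeriodicX n M →ₗ[k] PeriodicX n N
  | 0, _, _, f => f
  | _ + 1, _, _, f => f.prodMap f

/-- The differential of the periodic complex. -/
def periodicD : ∀ (n : ℕ) (M : GradedBimodule 𝒜), PeriodicX n M →ₗ[k] PeriodicX (n + 1) M
  | 0, M => C.evenD M ∘ₗ LinearMap.inl k M M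
  | n + 1, M => if Even n then C.oddD M else C.evenD M

/-- The contraction of the periodic complex. -/
def periodicH : ∀ (n : ℕ) (M : GradedBimodule 𝒜), PeriodicX (n + 1) M →ₗ[k] PeriodicX n M.coind
  | 0, M => C.oddH M
  | n + 1, M => if Even n then LinearMap.inr k _ _ ∘ₗ C.evenH M
    else LinearMap.inl k _ _ ∘ₗ C.oddH M

omit [SetLike.GradedMonoid 𝒜] in
theorem periodicD_even {n : ℕ} (hn : Even n) {M : GradedBimodule 𝒜} (p : M × M) :
    C.periodicD (n + 1) M p = C.oddD M p := by
  rw [periodicD, if_pos hn]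

omit [SetLike.GradedMonoid 𝒜] in
theorem periodicD_odd {n : ℕ} (hn : ¬Even n) {M : GradedBimodule 𝒜} (p : M × M) :
    C.periodicD (n + 1) M p = C.evenD M p := by
  rw [periodicD, if_neg hn]

theorem periodicH_even {n : ℕ} (hn : Even n) {M : GradedBimodule 𝒜} (p : M × M) :
    C.periodicH (n + 1) M p = (0, C.evenH M p) := by
  rw [periodicH, if_pos hn]; rfl

theorem periodicH_odd {n : ℕ} (hn : ¬Even n) {M : GradedBimodule 𝒜} (p : M × M) :
    C.periodicH (n + 1) M p = (C.oddH M p, 0) := by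
  rw [periodicH, if_neg hn]; rfl

omit [SetLike.GradedMonoid 𝒜] in
theorem shift_even {n : ℕ} (hn : Even n) : C.shift n =
    (((n / 2 : ℕ) : ℤ) * (C.a * C.β) + C.α, ((n / 2 : ℕ) : ℤ) * (C.a * C.β) + C.β) := if_pos hn

omit [SetLike.GradedMonoid 𝒜] in
theorem shift_odd {n : ℕ} (hn : ¬Even n) : C.shift n =
    (((n / 2 : ℕ) : ℤ) * (C.a * C.β) + C.a * C.β,
      ((n / 2 : ℕ) : ℤ) * (C.a * C.β) + C.α + C.β) := if_neg hn

omit [SetLike.GradedMonoid 𝒜] in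
theorem shift_succ_even {n : ℕ} (hn : Even n) : C.shift (n + 1) =
    (((n / 2 : ℕ) : ℤ) * (C.a * C.β) + C.a * C.β,
      ((n / 2 : ℕ) : ℤ) * (C.a * C.β) + C.α + C.β) := by
  rw [C.shift_odd (by rwa [Nat.even_add_one, not_not]),
    show (n + 1) / 2 = n / 2 by obtain ⟨m, rfl⟩ := hn; omega]

omit [SetLike.GradedMonoid 𝒜] in
theorem shift_succ_odd {n : ℕ} (hn : ¬Even n) : C.shift (n + 1) =
    (((n / 2 : ℕ) : ℤ) * (C.a * C.β) + C.a * C.β + C.α,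
      ((n / 2 : ℕ) : ℤ) * (C.a * C.β) + C.a * C.β + C.β) := by
  rw [C.shift_even (by rwa [Nat.even_add_one]),
    show (n + 1) / 2 = n / 2 + 1 by obtain ⟨m, rfl⟩ := Nat.not_even_iff_odd.1 hn; omega]
  push_cast
  refine Prod.ext ?_ ?_ <;> ring

variable {M : GradedBimodule 𝒜}

theorem evenD_mem {w₁ w₂ v₁ v₂ : ℤ} (h₁ : w₁ + C.α = v₁) (h₂ : w₂ + (C.a * C.β - C.β) = v₁)
    (h₃ : w₁ + C.β = v₂) (h₄ : w₂ + (C.b * C.α - C.α) = v₂) {p : M × M}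
    (hp : p ∈ (M.W w₁).prod (M.W w₂)) : C.evenD M p ∈ (M.W v₁).prod (M.W v₂) :=
  ⟨sub_mem (h₁ ▸ C.ξ_mem hp.1) (h₂ ▸ C.Δy_mem hp.2), add_mem (h₃ ▸ C.η_mem hp.1)
    (h₄ ▸ C.Δx_mem hp.2)⟩

theorem oddD_mem {w₁ w₂ v₁ v₂ : ℤ} (h₁ : w₁ + (C.b * C.α - C.α) = v₁)
    (h₂ : w₂ + (C.a * C.β - C.β) = v₁) (h₃ : w₂ + C.α = v₂) (h₄ : w₁ + C.β = v₂) {p : M × M}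
    (hp : p ∈ (M.W w₁).prod (M.W w₂)) : C.oddD M p ∈ (M.W v₁).prod (M.W v₂) :=
  ⟨add_mem (h₁ ▸ C.Δx_mem hp.1) (h₂ ▸ C.Δy_mem hp.2), sub_mem (h₃ ▸ C.ξ_mem hp.2)
    (h₄ ▸ C.η_mem hp.1)⟩

theorem oddH_mem {w₁ w₂ v : ℤ} (h₁ : w₁ - C.α = v) (h₂ : w₂ - C.β = v) {p : M × M}
    (hp : p ∈ (M.W w₁).prod (M.W w₂)) : C.oddH M p ∈ M.coind.W v :=
  add_mem (h₁ ▸ C.opK_mem (isHomogeneous_unit hp.1)) (h₂ ▸ C.opL_mem (isHomogeneous_unit hp.2))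

theorem evenH_mem {w₁ w₂ v : ℤ} (h₁ : w₁ - (C.a * C.β - C.β) = v) (h₂ : w₂ - C.α = v) {p : M × M}
    (hp : p ∈ (M.W w₁).prod (M.W w₂)) : C.evenH M p ∈ M.coind.W v :=
  add_mem (h₂ ▸ C.opK_mem (isHomogeneous_unit hp.2)) (h₁ ▸ C.opN_mem (isHomogeneous_unit hp.1))

theorem periodicD_mem (n : ℕ) {w : ℤ} {p : PeriodicX n M} (hp : p ∈ C.periodicW n M w) :
    C.periodicD n M p ∈ C.periodicW (n + 1) M w := by
  have hrel := C.weight_rel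
  rcases n with _ | n
  -- The zero component may be given any weight; this one fits the periodic pattern of shifts.
  · have h : ((p, 0) : M × M) ∈ (M.W w).prod (M.W (w + C.α + C.β - C.a * C.β)) :=
      ⟨hp, zero_mem _⟩
    refine C.evenD_mem ?_ ?_ ?_ ?_ h <;> simp [shift] <;> linarith
  · by_cases hn : Even n
    · rw [C.periodicD_even hn]
      refine C.oddD_mem ?_ ?_ ?_ ?_ hp <;> rw [C.shift_even hn, C.shift_succ_even hn] <;>
        dsimp only <;> linarith
    · rw [C.periodicD_odd hn]
      refine C.evenD_mem ?_ ?_ ?_ ?_ hp <;> rw [C.shift_odd hn, C.shift_succ_odd hn] <;>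
        dsimp only <;> linarith

theorem periodicH_mem (n : ℕ) {w : ℤ} {p : PeriodicX (n + 1) M}
    (hp : p ∈ C.periodicW (n + 1) M w) : C.periodicH n M p ∈ C.periodicW n M.coind w := by
  have hrel := C.weight_rel
  rcases n with _ | n
  · refine C.oddH_mem ?_ ?_ hp <;> simp [shift]
  · by_cases hn : Even n
    · rw [C.periodicH_even hn]
      refine ⟨zero_mem _, C.evenH_mem ?_ ?_ hp⟩ <;>
        rw [C.shift_even hn, C.shift_succ_even hn] <;> dsimp only <;> linarith
    · rw [C.periodicH_odd hn]
      refine ⟨C.oddH_mem ?_ ?_ hp, zero_mem _⟩ <;>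
        rw [C.shift_odd hn, C.shift_succ_odd hn] <;> dsimp only <;> linarith

/-- The periodic complex of a quasi-homogeneous plane curve. -/
def periodicComplex : NaturalComplex 𝒜 where
  X := PeriodicX
  W := C.periodicW
  map n _ _ f := periodicMap n f
  map_id n M := by cases n <;> rfl
  map_comp n _ _ _ g f := by cases n <;> rfl
  map_mem n _ _ f hf w x hx := by
    cases n with
    | zero => exact hf hx
    | succ n => exact ⟨hf hx.1, hf hx.2⟩
  zeroEquiv _ := LinearEquiv.refl k _
  zeroEquiv_map _ _ := rfl
  zeroEquiv_mem := Iff.rfl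
  d := C.periodicD
  d_d n M x := by
    rcases n with _ | n
    · rw [C.periodicD_even Even.zero]
      exact C.oddD_evenD _
    · by_cases hn : Even n
      · rw [C.periodicD_even hn, C.periodicD_odd (by rwa [Nat.even_add_one, not_not])]
        exact C.evenD_oddD _
      · rw [C.periodicD_odd hn, C.periodicD_even (by rwa [Nat.even_add_one])]
        exact C.oddD_evenD _
  d_map n M N f hf x := by
    rcases n with _ | n
    · refine Eq.trans ?_ (C.map_evenD hf (x, 0))
      change C.evenD N (f x, 0) = C.evenD N (f x, f 0)
      rw [map_zero]
    · by_cases hn : Even n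
      · rw [C.periodicD_even hn, C.periodicD_even hn]
        exact C.map_oddD hf x
      · rw [C.periodicD_odd hn, C.periodicD_odd hn]
        exact C.map_evenD hf x
  d_mem n _ _ _ := C.periodicD_mem n
  h := C.periodicH
  h_map n M N f hf x := by
    rcases n with _ | n
    · exact C.oddH_map hf x
    · by_cases hn : Even n
      · rw [C.periodicH_even hn, C.periodicH_even hn]
        exact Prod.ext (map_zero (coindMap f)).symm (C.evenH_map hf x)
      · rw [C.periodicH_odd hn, C.periodicH_odd hn]
        exact Prod.ext (C.oddH_map hf x) (map_zero (coindMap f)).symm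
  h_mem n _ _ _ := C.periodicH_mem n
  h_d_zero M x := C.oddH_evenD_zero x
  d_central M x := by
    change C.evenD M.coind (M.central x, 0) = 0
    simp [evenD_apply, C.ξ_central, C.η_central]
  h_d_add n M x := by
    rcases n with _ | n
    · rw [C.periodicH_even Even.zero, C.periodicD_even Even.zero]
      exact C.even_oddH_add x
    · by_cases hn : Even n
      · have hn' : ¬Even (n + 1) := by rwa [Nat.even_add_one, not_not]
        rw [C.periodicH_odd hn', C.periodicD_odd hn', C.periodicD_even hn, C.periodicH_even hn]
        exact C.odd_evenH_add x
      · have hn' : Even (n + 1) := by rwa [Nat.even_add_one]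
        rw [C.periodicH_even hn', C.periodicD_even hn', C.periodicD_odd hn, C.periodicH_odd hn]
        exact C.even_oddH_add x

end complex

end QuasiHomogeneousCurve

/-! ### The numerical semigroup algebra as a quasi-homogeneous curve -/

section Semigroup

variable {k : Type u} [Field k] {a b : ℕ}

instance : SetLike.GradedMonoid (numericalSemigroupPiece k a b) where
  one_mem i hi := by
    rw [OneMemClass.coe_one, coeff_one] at hi
    by_contra h
    exact hi (if_neg (by exact_mod_cast h))
  mul_mem d e f g hf hg i hi := by
    rw [MulMemClass.coe_mul, coeff_mul] at hi
    obtain ⟨p, hp, hne⟩ := Finset.exists_ne_zero_of_sum_ne_zero hi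
    rw [← Finset.HasAntidiagonal.mem_antidiagonal.1 hp, Nat.cast_add, hf _ (left_ne_zero_of_mul hne),
      hg _ (right_ne_zero_of_mul hne)]

variable (k a b)

/-- The generator `s ^ a`. -/
def semigroupX : numericalSemigroupAlgebra k a b :=
  ⟨X ^ a, Algebra.subset_adjoin (Set.mem_insert _ _)⟩

/-- The generator `s ^ b`. -/
def semigroupY : numericalSemigroupAlgebra k a b :=
  ⟨X ^ b, Algebra.subset_adjoin (Set.mem_insert_of_mem _ rfl)⟩

variable {k a b}

theorem coe_semigroupX_pow_mul (i j : ℕ) :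
    ((semigroupX k a b ^ i * semigroupY k a b ^ j : numericalSemigroupAlgebra k a b) : k[X]) =
      X ^ (a * i + b * j) := by
  simp [semigroupX, semigroupY, pow_add, pow_mul]

theorem semigroupX_pow_eq : semigroupX k a b ^ b = semigroupY k a b ^ a := by
  ext1
  simp [semigroupX, semigroupY, ← pow_mul, mul_comm]

/-- Modulo `a` the degree is `b j`, which determines `j < a` by coprimality. -/
theorem injective_semigroup_degree (ha : 0 < a) (hab : a.Coprime b) :
    Function.Injective fun i : ℕ × Fin a => a * i.1 + b * (i.2 : ℕ) := by
  rintro ⟨i, j, hj⟩ ⟨i', j', hj'⟩ h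
  simp only at h
  have h1 : b * j ≡ b * j' [MOD a] := by
    have := congrArg (· % a) h
    simpa [Nat.ModEq, Nat.add_mod] using this
  have h2 : j = j' := (Nat.ModEq.cancel_left_of_coprime hab h1).eq_of_lt_of_lt hj hj'
  subst h2
  have h3 : i = i' := Nat.eq_of_mul_eq_mul_left ha (by omega)
  subst h3
  rfl

theorem linearIndependent_semigroup_monomials (ha : 0 < a) (hab : a.Coprime b) :
    LinearIndependent k fun i : ℕ × Fin a =>
      semigroupX k a b ^ i.1 * semigroupY k a b ^ (i.2 : ℕ) := by
  refine LinearIndependent.of_comp (numericalSemigroupAlgebra k a b).val.toLinearMap ?_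
  have := (Polynomial.basisMonomials k).linearIndependent.comp _
    (injective_semigroup_degree ha hab)
  convert this using 1
  · ext1 i
    refine (coe_semigroupX_pow_mul _ _).trans ?_
    simp [X_pow_eq_monomial]
  · rfl

theorem span_semigroup_monomials (ha : 0 < a) :
    ⊤ ≤ Submodule.span k (Set.range fun i : ℕ × Fin a =>
      semigroupX k a b ^ i.1 * semigroupY k a b ^ (i.2 : ℕ)) := by
  rintro ⟨z, hz⟩ -
  have hz' : z ∈ Submodule.span k (Submonoid.closure ({X ^ a, X ^ b} : Set k[X]) : Set k[X]) := by
    rw [← Algebra.adjoin_eq_span]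
    exact hz
  obtain ⟨h, h'⟩ : ∃ h : z ∈ numericalSemigroupAlgebra k a b,
      (⟨z, h⟩ : numericalSemigroupAlgebra k a b) ∈ Submodule.span k (Set.range
        fun i : ℕ × Fin a => semigroupX k a b ^ i.1 * semigroupY k a b ^ (i.2 : ℕ)) := by
    clear hz
    induction hz' using Submodule.span_induction with
    | mem z hz =>
      obtain ⟨m, n, rfl⟩ := (Submonoid.mem_closure_pair _ _ _).1 hz
      -- Each factor `y^a` is traded for `x^b`, so `n` is reduced modulo `a`.
      have e : (X ^ a) ^ m * (X ^ b) ^ n = ((semigroupX k a b ^ (m + b * (n / a)) *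
          semigroupY k a b ^ (n % a) : numericalSemigroupAlgebra k a b) : k[X]) := by
        rw [coe_semigroupX_pow_mul, ← pow_mul, ← pow_mul, ← pow_add]
        congr 1
        conv_lhs => rw [← Nat.div_add_mod n a]
        ring
      rw [e]
      exact ⟨Subtype.property _, Submodule.subset_span ⟨(_, ⟨n % a, Nat.mod_lt _ ha⟩), rfl⟩⟩
    | zero => exact ⟨zero_mem _, zero_mem _⟩
    | add f g _ _ hf hg =>
      obtain ⟨h1, h1'⟩ := hf
      obtain ⟨h2, h2'⟩ := hg
      exact ⟨add_mem h1 h2, add_mem h1' h2'⟩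
    | smul c f _ hf =>
      obtain ⟨h1, h1'⟩ := hf
      exact ⟨Subalgebra.smul_mem _ h1 c, Submodule.smul_mem _ c h1'⟩
  exact h'

variable (k) in
/-- The basis of monomials `s ^ (a i + b j)` with `j < a`. -/
def semigroupBasis (ha : 0 < a) (hab : a.Coprime b) :
    Module.Basis (ℕ × Fin a) k (numericalSemigroupAlgebra k a b) :=
  Module.Basis.mk (linearIndependent_semigroup_monomials ha hab) (span_semigroup_monomials ha)

theorem semigroupBasis_apply (ha : 0 < a) (hab : a.Coprime b) (i : ℕ × Fin a) :
    semigroupBasis k ha hab i = semigroupX k a b ^ i.1 * semigroupY k a b ^ (i.2 : ℕ) :=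
  Module.Basis.mk_apply _ _ _

theorem semigroupBasis_repr (ha : 0 < a) (hab : a.Coprime b)
    (z : numericalSemigroupAlgebra k a b) (i : ℕ × Fin a) :
    (semigroupBasis k ha hab).repr z i = (z : k[X]).coeff (a * i.1 + b * (i.2 : ℕ)) := by
  have : (semigroupBasis k ha hab).coord i =
      lcoeff k (a * i.1 + b * (i.2 : ℕ)) ∘ₗ (numericalSemigroupAlgebra k a b).val.toLinearMap := by
    refine (semigroupBasis k ha hab).ext fun j => ?_
    have h : lcoeff k (a * i.1 + b * (i.2 : ℕ)) ((semigroupBasis k ha hab j :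
        numericalSemigroupAlgebra k a b) : k[X]) = if i = j then 1 else 0 := by
      rw [semigroupBasis_apply, coe_semigroupX_pow_mul, lcoeff_apply, coeff_X_pow]
      exact if_congr (injective_semigroup_degree ha hab).eq_iff rfl rfl
    refine Eq.trans ?_ h.symm
    simp [Finsupp.single_apply, eq_comm]
  exact LinearMap.congr_fun this z

variable (k) in
/-- The numerical semigroup algebra is the coordinate ring of the curve `x ^ b = y ^ a`. -/
def semigroupCurve (ha : 0 < a) (hab : a.Coprime b) :
    QuasiHomogeneousCurve (numericalSemigroupPiece k a b) where
  a := a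
  b := b
  a_pos := ha
  x := semigroupX k a b
  y := semigroupY k a b
  α := a
  β := b
  x_mem i hi := by
    by_contra h
    exact hi (by rw [semigroupX, coeff_X_pow, if_neg (by exact_mod_cast h)])
  y_mem i hi := by
    by_contra h
    exact hi (by rw [semigroupY, coeff_X_pow, if_neg (by exact_mod_cast h)])
  rel := semigroupX_pow_eq
  weight_rel := mul_comm _ _
  basis := semigroupBasis k ha hab
  basis_apply := semigroupBasis_apply ha hab
  repr_weight {e z i} hz hi := by
    rw [semigroupBasis_repr] at hi
    rw [← hz _ hi]
    push_cast
    ring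

theorem exists_semigroup_component (ha : 0 < a) (z : numericalSemigroupAlgebra k a b) (d : ℤ) :
    ∃ u ∈ numericalSemigroupPiece k a b d,
      ∀ i : ℕ, (i : ℤ) = d → (u : k[X]).coeff i = (z : k[X]).coeff i := by
  induction span_semigroup_monomials ha (Submodule.mem_top (x := z)) using
    Submodule.span_induction with
  | mem z hz =>
    obtain ⟨i, rfl⟩ := hz
    have hc (n : ℕ) : ((semigroupX k a b ^ i.1 * semigroupY k a b ^ (i.2 : ℕ) :
        numericalSemigroupAlgebra k a b) : k[X]).coeff n =
        if n = a * i.1 + b * (i.2 : ℕ) then 1 else 0 := by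
      rw [coe_semigroupX_pow_mul, coeff_X_pow]
    by_cases h : ((a * i.1 + b * (i.2 : ℕ) : ℕ) : ℤ) = d
    · refine ⟨_, fun n hn => ?_, fun _ _ => rfl⟩
      rw [hc] at hn
      rw [← h, not_not.1 fun h' => hn (if_neg h')]
    · refine ⟨0, zero_mem _, fun n hn => ?_⟩
      rw [hc, if_neg (by rintro rfl; exact h hn)]
      exact coeff_zero n
  | zero => exact ⟨0, zero_mem _, fun _ _ => rfl⟩
  | add f g _ _ hf hg =>
    obtain ⟨u, hu, hu'⟩ := hf
    obtain ⟨v, hv, hv'⟩ := hg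
    refine ⟨u + v, add_mem hu hv, fun n hn => ?_⟩
    rw [AddMemClass.coe_add, AddMemClass.coe_add, coeff_add, coeff_add, hu' n hn, hv' n hn]
  | smul c f _ hf =>
    obtain ⟨u, hu, hu'⟩ := hf
    refine ⟨c • u, Submodule.smul_mem _ c hu, fun n hn => ?_⟩
    rw [SetLike.val_smul, SetLike.val_smul, coeff_smul, coeff_smul, hu' n hn]

theorem semigroupPiece_ext {d : ℤ} {z z' : numericalSemigroupAlgebra k a b}
    (hz : z ∈ numericalSemigroupPiece k a b d) (hz' : z' ∈ numericalSemigroupPiece k a b d)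
    (h : ∀ i : ℕ, (i : ℤ) = d → (z : k[X]).coeff i = (z' : k[X]).coeff i) : z = z' := by
  ext i
  by_cases hi : (i : ℤ) = d
  · exact h i hi
  · rw [not_not.1 (mt (hz i) hi), not_not.1 (mt (hz' i) hi)]

end Semigroup

/-! ### Hochschild classes from the periodic complex -/

namespace NaturalComplex

variable {k A : Type u} [Field k] [CommRing A] [Algebra k A] {𝒜 : ℤ → Submodule k A}
  [SetLike.GradedMonoid 𝒜] {F G : NaturalComplex 𝒜} {M : GradedBimodule 𝒜}

theorem IsCoboundary.add {n : ℕ} {x y : F.X n M} (hx : F.IsCoboundary n x)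
    (hy : F.IsCoboundary n y) : F.IsCoboundary n (x + y) := by
  cases n with
  | zero => exact (congrArg₂ (· + ·) hx hy).trans (add_zero _)
  | succ n =>
    obtain ⟨x, rfl⟩ := hx
    obtain ⟨y, rfl⟩ := hy
    exact ⟨x + y, map_add _ _ _⟩

theorem d_comparison {n : ℕ} {x : F.X n M} (hx : F.d n M x = 0) :
    G.d n M (NaturalComplex.comparison F G n M x) = 0 := by
  rw [← comparison_d, hx, map_zero]

/-- Coboundaries are reflected because the round trip differs from the identity by a coboundary on
cocycles. -/
theorem isCoboundary_comparison_iff {n : ℕ} {x : F.X n M} (hx : F.d n M x = 0) :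
    G.IsCoboundary n (NaturalComplex.comparison F G n M x) ↔ F.IsCoboundary n x := by
  refine ⟨fun h => ?_, IsCoboundary.comparison⟩
  have := (isCoboundary_roundTrip (G := G) n hx).add (h.comparison (G := F))
  rwa [sub_add_cancel] at this

end NaturalComplex

namespace QuasiHomogeneousCurve

variable {k A : Type u} [Field k] [CommRing A] [Algebra k A] {𝒜 : ℤ → Submodule k A}
  [SetLike.GradedMonoid 𝒜] (C : QuasiHomogeneousCurve 𝒜)

/-- The partial derivative of `x ^ b - y ^ a` with respect to `x`, as a multiplication operator. -/
def xDeriv : A →ₗ[k] A := (C.b : k) • LinearMap.mulLeft k (C.x ^ (C.b - 1))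

omit [SetLike.GradedMonoid 𝒜] in
theorem xDeriv_apply (z : A) : C.xDeriv z = (C.b : k) • (C.x ^ (C.b - 1) * z) := rfl

theorem regular_ξ (z : A) : C.ξ (regular 𝒜) z = 0 := sub_self _

theorem regular_η (z : A) : C.η (regular 𝒜) z = 0 := sub_self _

theorem regular_Δx (z : A) : C.Δx (regular 𝒜) z = C.xDeriv z := by
  rw [Δx_apply, xDeriv_apply]
  refine (Finset.sum_congr rfl fun i hi => ?_ : _ = ∑ i ∈ Finset.range C.b,
    C.x ^ (C.b - 1) * z).trans ?_
  · rw [Finset.mem_range] at hi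
    change C.x ^ i * (C.x ^ (C.b - 1 - i) * z) = _
    rw [← mul_assoc, ← pow_add, show i + (C.b - 1 - i) = C.b - 1 by omega]
  · rw [Finset.sum_const, Finset.card_range, Nat.cast_smul_eq_nsmul]

theorem regular_Δy (ha : (C.a : k) = 0) (z : A) : C.Δy (regular 𝒜) z = 0 := by
  rw [Δy_apply, neg_eq_zero]
  refine (Finset.sum_congr rfl fun i hi => ?_ : _ = ∑ i ∈ Finset.range C.a,
    C.y ^ (C.a - 1) * z).trans ?_
  · rw [Finset.mem_range] at hi
    change C.y ^ i * (C.y ^ (C.a - 1 - i) * z) = _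
    rw [← mul_assoc, ← pow_add, show i + (C.a - 1 - i) = C.a - 1 by omega]
  · rw [Finset.sum_const, Finset.card_range, ← Nat.cast_smul_eq_nsmul k, ha, zero_smul]

/-- Over `A` itself only `Δx`, multiplication by `b x^(b-1)`, survives. The periodic complex then
splits into pieces with at most one nonzero arrow. -/
theorem regular_evenD (ha : (C.a : k) = 0) (p : A × A) :
    C.evenD (regular 𝒜) p = (0, C.xDeriv p.2) := by
  rw [evenD_apply, regular_ξ, regular_η, regular_Δx, C.regular_Δy ha]
  exact Prod.ext (sub_zero _) (zero_add _)

theorem regular_oddD (ha : (C.a : k) = 0) (p : A × A) :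
    C.oddD (regular 𝒜) p = (C.xDeriv p.1, 0) := by
  rw [oddD_apply, regular_ξ, regular_η, regular_Δx, C.regular_Δy ha]
  exact Prod.ext (add_zero _) (sub_zero _)

variable (𝒜) in
/-- The representatives of the classes of the periodic complex. -/
def representative : ∀ n : ℕ, A →ₗ[k] PeriodicX n (regular 𝒜)
  | 0 => LinearMap.id
  -- The component chosen is the one on which the outgoing differential vanishes; on the other it is
  -- `xDeriv`.
  | n + 1 => if Even n then LinearMap.inr k A A else LinearMap.inl k A A

/-- The weight shift of the classes of degree `n`. -/
def degShift : ℕ → ℤ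
  | 0 => 0
  | n + 1 => if Even n then (C.shift n).2 else (C.shift n).1

/-- The operator whose image consists of the trivial classes of degree `n`. -/
def boundary (n : ℕ) : A →ₗ[k] A := if n ≤ 1 then 0 else C.xDeriv

theorem representative_even {n : ℕ} (hn : Even n) (z : A) :
    representative 𝒜 (n + 1) z = (0, z) := by
  rw [representative, if_pos hn]; rfl

theorem representative_odd {n : ℕ} (hn : ¬Even n) (z : A) :
    representative 𝒜 (n + 1) z = (z, 0) := by
  rw [representative, if_neg hn]; rfl

theorem representative_mem {n : ℕ} {z : A} {w : ℤ} :
    representative 𝒜 n z ∈ C.periodicW n (regular 𝒜) w ↔ z ∈ 𝒜 (w + C.degShift n) := by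
  rcases n with _ | n
  · rw [degShift, add_zero]; rfl
  · by_cases hn : Even n
    · rw [representative_even hn, degShift, if_pos hn]
      exact and_iff_right (zero_mem _)
    · rw [representative_odd hn, degShift, if_neg hn]
      exact and_iff_left (zero_mem _)

theorem periodicD_representative (ha : (C.a : k) = 0) (n : ℕ) (z : A) :
    C.periodicD n (regular 𝒜) (representative 𝒜 n z) = 0 := by
  rcases n with _ | n
  · refine (C.regular_evenD ha (z, 0)).trans ?_
    rw [map_zero]; rfl
  · by_cases hn : Even n
    · rw [representative_even hn, C.periodicD_even hn, C.regular_oddD ha, map_zero]; rfl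
    · rw [representative_odd hn, C.periodicD_odd hn, C.regular_evenD ha, map_zero]; rfl

theorem exists_representative (ha : (C.a : k) = 0) (hx : Function.Injective C.xDeriv) (n : ℕ)
    {p : PeriodicX n (regular 𝒜)} (hp : C.periodicD n (regular 𝒜) p = 0) :
    ∃ z, representative 𝒜 n z = p := by
  rcases n with _ | n
  · exact ⟨p, rfl⟩
  · by_cases hn : Even n
    · rw [C.periodicD_even hn, C.regular_oddD ha] at hp
      refine ⟨p.2, (representative_even hn _).trans (Prod.ext ?_ rfl)⟩
      exact ((map_eq_zero_iff _ hx).1 (congrArg Prod.fst hp)).symm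
    · rw [C.periodicD_odd hn, C.regular_evenD ha] at hp
      refine ⟨p.1, (representative_odd hn _).trans (Prod.ext rfl ?_)⟩
      exact ((map_eq_zero_iff _ hx).1 (congrArg Prod.snd hp)).symm

/-- Degree 1 has no nonzero coboundaries because degree 0 lacks the component on which `Δx` acts.
From degree 2 on, the representatives receive the image of `xDeriv`. -/
theorem isCoboundary_representative (ha : (C.a : k) = 0) (n : ℕ) (z : A) :
    C.periodicComplex.IsCoboundary n (M := regular 𝒜) (representative 𝒜 n z) ↔
      z ∈ LinearMap.range (C.boundary n) := by
  rw [LinearMap.mem_range]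
  rcases n with _ | _ | n
  · exact ⟨fun h => ⟨0, Eq.trans (map_zero _) h.symm⟩, fun ⟨t, ht⟩ => ht.symm⟩
  · rw [representative_even Even.zero]
    constructor
    · rintro ⟨t, ht⟩
      have ht' : C.evenD (regular 𝒜) (t, 0) = (0, z) := ht
      rw [C.regular_evenD ha, map_zero] at ht'
      exact ⟨0, (map_zero _).trans (congrArg Prod.snd ht')⟩
    · rintro ⟨t, rfl⟩
      exact ⟨0, map_zero _⟩
  · have hb : C.boundary (n + 1 + 1) = C.xDeriv := if_neg (by omega)
    rw [hb]
    by_cases hn : Even n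
    · rw [representative_odd (by rwa [Nat.even_add_one, not_not])]
      constructor
      · rintro ⟨t, ht⟩
        have ht' := (C.regular_oddD ha t).symm.trans ((C.periodicD_even hn t).symm.trans ht)
        exact ⟨t.1, congrArg Prod.fst ht'⟩
      · rintro ⟨t, rfl⟩
        exact ⟨(t, 0), (C.periodicD_even hn _).trans (C.regular_oddD ha _)⟩
    · rw [representative_even (by rwa [Nat.even_add_one])]
      constructor
      · rintro ⟨t, ht⟩
        have ht' := (C.regular_evenD ha t).symm.trans ((C.periodicD_odd hn t).symm.trans ht)
        exact ⟨t.2, congrArg Prod.snd ht'⟩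
      · rintro ⟨t, rfl⟩
        exact ⟨(0, t), (C.periodicD_odd hn _).trans (C.regular_evenD ha _)⟩

/-- The Hochschild cocycle attached to an element of `A`. -/
def cocycleMap (ha : (C.a : k) = 0) (n : ℕ) : A →ₗ[k] hochschildCocycles k A n :=
  LinearMap.codRestrict _ ((hochschildEquiv 𝒜 n).toLinearMap ∘ₗ
    NaturalComplex.comparison C.periodicComplex (barComplex 𝒜) n (regular 𝒜) ∘ₗ representative 𝒜 n)
    fun z => (hochschildEquiv_mem_cocycles 𝒜).2
      (NaturalComplex.d_comparison (G := barComplex 𝒜) (C.periodicD_representative ha n z))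

theorem coe_cocycleMap (ha : (C.a : k) = 0) (n : ℕ) (z : A) :
    (C.cocycleMap ha n z : HochschildCochain k A n) = hochschildEquiv 𝒜 n
      (NaturalComplex.comparison C.periodicComplex (barComplex 𝒜) n (regular 𝒜) (representative 𝒜 n z)) := rfl

/-- The Hochschild class attached to an element of `A`. -/
def classMap (ha : (C.a : k) = 0) (n : ℕ) : A →ₗ[k] HochschildCohomology k A n :=
  Submodule.mkQ _ ∘ₗ C.cocycleMap ha n

theorem ker_classMap (ha : (C.a : k) = 0) (n : ℕ) :
    LinearMap.ker (C.classMap ha n) = LinearMap.range (C.boundary n) := by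
  ext z
  rw [LinearMap.mem_ker, classMap, LinearMap.comp_apply, Submodule.mkQ_apply,
    Submodule.Quotient.mk_eq_zero, Submodule.mem_comap, Submodule.subtype_apply, coe_cocycleMap,
    ← C.isCoboundary_representative ha]
  refine (hochschildEquiv_mem_coboundaries 𝒜).trans ?_
  exact NaturalComplex.isCoboundary_comparison_iff (G := barComplex 𝒜) (C.periodicD_representative ha n z)

/-- Every cocycle is cohomologous to one coming from the periodic complex, of the same weight. -/
theorem exists_classMap_eq (ha : (C.a : k) = 0) (hx : Function.Injective C.xDeriv) (n : ℕ)
    (f : hochschildCocycles k A n) : ∃ z, C.classMap ha n z = Submodule.Quotient.mk f ∧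
      ∀ w, (f : HochschildCochain k A n) ∈ weightCochains 𝒜 n w → z ∈ 𝒜 (w + C.degShift n) := by
  obtain ⟨f, hf⟩ := f
  obtain ⟨g, rfl⟩ := (hochschildEquiv 𝒜 n).surjective f
  have hg : (barComplex 𝒜).d n (regular 𝒜) g = 0 := (hochschildEquiv_mem_cocycles 𝒜).1 hf
  obtain ⟨z, hz⟩ := C.exists_representative ha hx n
    (NaturalComplex.d_comparison (G := C.periodicComplex) hg)
  refine ⟨z, ?_, fun w hw => ?_⟩
  · symm
    refine (Submodule.Quotient.eq _).2 ?_
    have h := NaturalComplex.isCoboundary_roundTrip (G := C.periodicComplex) n hg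
    rw [← hz] at h
    have := (hochschildEquiv_mem_coboundaries 𝒜).2 h
    have e := map_sub (hochschildEquiv 𝒜 n) g
      (NaturalComplex.comparison C.periodicComplex (barComplex 𝒜) n (regular 𝒜) (representative 𝒜 n z))
    exact (congrArg (· ∈ hochschildCoboundaries k A n) e).mp this
  · rw [← C.representative_mem, hz]
    exact NaturalComplex.comparison_mem (F := barComplex 𝒜) (G := C.periodicComplex) n
      ((hochschildEquiv_mem 𝒜).1 hw)

theorem surjective_classMap (ha : (C.a : k) = 0) (hx : Function.Injective C.xDeriv) (n : ℕ) :
    Function.Surjective (C.classMap ha n) := fun c => by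
  obtain ⟨f, rfl⟩ := Submodule.Quotient.mk_surjective _ c
  obtain ⟨z, hz, -⟩ := C.exists_classMap_eq ha hx n f
  exact ⟨z, hz⟩

/-- Both comparison maps preserve weights, so classes of weight `w` and homogeneous elements of the
shifted degree correspond in both directions. -/
theorem hochschildCohomologyPiece_eq_map (ha : (C.a : k) = 0)
    (hx : Function.Injective C.xDeriv) (n : ℕ) (w : ℤ) :
    hochschildCohomologyPiece 𝒜 n w = (𝒜 (w + C.degShift n)).map (C.classMap ha n) := by
  apply le_antisymm
  · rintro _ ⟨f, hf, rfl⟩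
    obtain ⟨z, hz, hzw⟩ := C.exists_classMap_eq ha hx n f
    exact ⟨z, hzw w hf, hz⟩
  · rintro _ ⟨z, hz, rfl⟩
    refine ⟨C.cocycleMap ha n z, ?_, rfl⟩
    exact (hochschildEquiv_mem 𝒜).2 (NaturalComplex.comparison_mem (G := barComplex 𝒜) n
      (C.representative_mem.2 hz))

end QuasiHomogeneousCurve

/-! ### Homogeneity of the coboundary operator on `k[s^a, s^b]` -/

section Semigroup

variable {k : Type u} [Field k] {a b : ℕ}

section boundary

variable (ha : 0 < a) (hab : a.Coprime b)

theorem natCast_ne_zero_of_coprime (hab : a.Coprime b) (ha0 : (a : k) = 0) : (b : k) ≠ 0 := by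
  intro hb0
  rw [ringChar.spec] at ha0 hb0
  have := (ringChar.spec k 1).2 (hab ▸ Nat.dvd_gcd ha0 hb0)
  exact one_ne_zero (Nat.cast_one.symm.trans this)

theorem coeff_xDeriv (z : numericalSemigroupAlgebra k a b) (i : ℕ) :
    (((semigroupCurve k ha hab).xDeriv z : numericalSemigroupAlgebra k a b) : k[X]).coeff i =
      (b : k) * if a * (b - 1) ≤ i then (z : k[X]).coeff (i - a * (b - 1)) else 0 := by
  have : (((semigroupCurve k ha hab).xDeriv z : numericalSemigroupAlgebra k a b) : k[X]) =
      (b : k) • (X ^ (a * (b - 1)) * (z : k[X])) := by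
    rw [pow_mul]; rfl
  rw [this, coeff_smul, coeff_X_pow_mul', smul_eq_mul]

theorem injective_xDeriv (hb0 : (b : k) ≠ 0) :
    Function.Injective (semigroupCurve k ha hab).xDeriv := by
  rw [injective_iff_map_eq_zero]
  intro z hz
  ext i
  have := coeff_xDeriv ha hab z (i + a * (b - 1))
  rw [hz, if_pos (Nat.le_add_left _ _), Nat.add_sub_cancel, eq_comm] at this
  exact (mul_eq_zero.1 this).resolve_left hb0

theorem exists_coeff_boundary (n : ℕ) : ∃ c : k, ∀ (z : numericalSemigroupAlgebra k a b) (i : ℕ),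
    (((semigroupCurve k ha hab).boundary n z : numericalSemigroupAlgebra k a b) : k[X]).coeff i =
      c * if a * (b - 1) ≤ i then (z : k[X]).coeff (i - a * (b - 1)) else 0 := by
  by_cases hn : n ≤ 1
  · refine ⟨0, fun z i => ?_⟩
    rw [QuasiHomogeneousCurve.boundary, if_pos hn, zero_mul]
    rfl
  · refine ⟨b, fun z i => ?_⟩
    rw [QuasiHomogeneousCurve.boundary, if_neg hn, coeff_xDeriv]

theorem boundary_mem (n : ℕ) {z : numericalSemigroupAlgebra k a b} {d : ℤ}
    (hz : z ∈ numericalSemigroupPiece k a b (d - (a * (b - 1) : ℕ))) :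
    (semigroupCurve k ha hab).boundary n z ∈ numericalSemigroupPiece k a b d := by
  obtain ⟨c, hc⟩ := exists_coeff_boundary (k := k) ha hab n
  intro i hi
  rw [hc] at hi
  have h := right_ne_zero_of_mul hi
  by_cases hN : a * (b - 1) ≤ i
  · rw [if_pos hN] at h
    have := hz _ h
    push_cast [hN] at this
    omega
  · exact absurd (if_neg hN) h

/-- A homogeneous component of an element of the image is the image of a homogeneous element. -/
theorem exists_boundary_eq (n : ℕ) {d : ℤ} {v : numericalSemigroupAlgebra k a b}
    (hv : v ∈ numericalSemigroupPiece k a b d) (t : numericalSemigroupAlgebra k a b)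
    (h : ∀ i : ℕ, (i : ℤ) = d → (((semigroupCurve k ha hab).boundary n t :
      numericalSemigroupAlgebra k a b) : k[X]).coeff i = (v : k[X]).coeff i) :
    ∃ u ∈ numericalSemigroupPiece k a b (d - (a * (b - 1) : ℕ)),
      (semigroupCurve k ha hab).boundary n u = v := by
  obtain ⟨u, hu, hut⟩ := exists_semigroup_component ha t (d - (a * (b - 1) : ℕ))
  obtain ⟨r, hr⟩ := exists_coeff_boundary (k := k) ha hab n
  refine ⟨u, hu, semigroupPiece_ext (boundary_mem ha hab n hu) hv fun i hi => ?_⟩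
  rw [← h i hi, hr, hr]
  split_ifs with hN
  · rw [hut _ (by push_cast [hN]; omega)]
  · rfl

/-- Membership in the image of a homogeneous operator is detected on homogeneous components. -/
theorem mem_range_boundary_of_sum (n : ℕ) (c : ℤ) (s : Finset ℤ)
    (v : ℤ → numericalSemigroupAlgebra k a b)
    (hv : ∀ w ∈ s, v w ∈ numericalSemigroupPiece k a b (w + c))
    (hs : ∑ w ∈ s, v w ∈ LinearMap.range ((semigroupCurve k ha hab).boundary n)) :
    ∀ w ∈ s, v w ∈ LinearMap.range ((semigroupCurve k ha hab).boundary n) := by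
  intro w hw
  obtain ⟨t, ht⟩ := hs
  obtain ⟨u, -, hu⟩ := exists_boundary_eq ha hab n (hv w hw) t fun i hi => by
    rw [ht, AddSubmonoidClass.coe_finsetSum, finsetSum_coeff, Finset.sum_eq_single_of_mem w hw]
    intro w' hw' hne
    by_contra h
    have := hv w' hw' i h
    omega
  exact ⟨u, hu⟩

end boundary

theorem finite_semigroupPiece (d : ℤ) : Module.Finite k (numericalSemigroupPiece k a b d) := by
  -- The coefficient at `s^d` determines the element. For negative `d` the default `d.toNat = 0` is
  -- harmless, since the piece is zero.
  refine Module.Finite.of_injective (lcoeff k d.toNat ∘ₗ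
    (numericalSemigroupAlgebra k a b).val.toLinearMap ∘ₗ
    (numericalSemigroupPiece k a b d).subtype) ?_
  rw [injective_iff_map_eq_zero]
  rintro ⟨z, hz⟩ h
  refine Subtype.ext (semigroupPiece_ext hz (zero_mem _) fun i hi => ?_)
  rw [show i = d.toNat by omega]
  exact h

theorem numericalSemigroupPiece_of_neg {d : ℤ} (hd : d < 0) :
    numericalSemigroupPiece k a b d = ⊥ :=
  (Submodule.eq_bot_iff _).2 fun z hz =>
    semigroupPiece_ext hz (zero_mem _) fun i hi => by omega

theorem coeff_numericalSemigroupHilbertSeries (d : ℤ) :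
    (numericalSemigroupHilbertSeries k a b).coeff d =
      Module.finrank k (numericalSemigroupPiece k a b d) := by
  rcases lt_or_ge d 0 with hd | hd
  · rw [numericalSemigroupPiece_of_neg hd, finrank_bot, Nat.cast_zero,
      numericalSemigroupHilbertSeries, HahnSeries.ofPowerSeries_apply]
    refine HahnSeries.embDomain_of_notMem_range ?_
    rintro ⟨n, rfl⟩
    exact absurd hd (not_lt.2 (Int.natCast_nonneg n))
  · obtain ⟨n, rfl⟩ := Int.eq_ofNat_of_zero_le hd
    rw [numericalSemigroupHilbertSeries, HahnSeries.ofPowerSeries_apply_coeff,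
      PowerSeries.coeff_mk]

/-! ### Weight decomposition and dimensions of the pieces -/

section cohomology

variable (ha : 0 < a) (hab : a.Coprime b) (ha0 : (a : k) = 0)

include ha hab ha0

/-- Independence: lift a vanishing sum of classes to homogeneous elements of `A`. Their sum lies in
the image of a homogeneous operator, hence so does each summand. Spanning: the monomials are
homogeneous and span `A`. -/
theorem isInternal_hochschildCohomologyPiece (n : ℕ) : DirectSum.IsInternal
    (hochschildCohomologyPiece (numericalSemigroupPiece k a b) n) := by
  have hx := injective_xDeriv ha hab (natCast_ne_zero_of_coprime hab ha0)
  set C := semigroupCurve k ha hab with hC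
  have hP := C.hochschildCohomologyPiece_eq_map ha0 hx n
  apply DirectSum.isInternal_submodule_of_iSupIndep_of_iSup_eq_top
  · rw [iSupIndep_iff_finsetSum_eq_zero_imp_eq_zero]
    intro s v hv hs
    have hv' (w : ℤ) : ∃ z, w ∈ s → z ∈ numericalSemigroupPiece k a b (w + C.degShift n) ∧
        C.classMap ha0 n z = v w := by
      by_cases hw : w ∈ s
      · have := hv w hw
        rw [hP] at this
        obtain ⟨z, hz⟩ := this
        exact ⟨z, fun _ => hz⟩
      · exact ⟨0, fun h => absurd h hw⟩
    choose z hz using hv'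
    have hsum : ∑ w ∈ s, z w ∈ LinearMap.range (C.boundary n) := by
      rw [← C.ker_classMap ha0, LinearMap.mem_ker, map_sum, ← hs]
      exact Finset.sum_congr rfl fun w hw => (hz w hw).2
    intro w hw
    have := mem_range_boundary_of_sum ha hab n _ s z (fun w hw => (hz w hw).1) hsum w hw
    rw [← hC, ← C.ker_classMap ha0, LinearMap.mem_ker, (hz w hw).2] at this
    exact this
  · rw [eq_top_iff]
    rintro x -
    obtain ⟨z, rfl⟩ := C.surjective_classMap ha0 hx n x
    have h : Submodule.span k (Set.range fun i : ℕ × Fin a =>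
        semigroupX k a b ^ i.1 * semigroupY k a b ^ (i.2 : ℕ)) ≤
        (⨆ w, hochschildCohomologyPiece (numericalSemigroupPiece k a b) n w).comap
          (C.classMap ha0 n) := by
      rw [Submodule.span_le]
      rintro _ ⟨i, rfl⟩
      have hm := SetLike.mul_mem_graded (C.x_pow_mem i.1) (C.y_pow_mem i.2)
      refine Submodule.mem_iSup_of_mem
        (i.1 * C.α + (i.2 : ℕ) * C.β - C.degShift n) ?_
      rw [hP, sub_add_cancel]
      exact Submodule.mem_map_of_mem hm
    exact h (span_semigroup_monomials ha Submodule.mem_top)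

theorem finite_hochschildCohomologyPiece (n : ℕ) (w : ℤ) : Module.Finite k
    (hochschildCohomologyPiece (numericalSemigroupPiece k a b) n w) := by
  have hx := injective_xDeriv ha hab (natCast_ne_zero_of_coprime hab ha0)
  have := finite_semigroupPiece (k := k) (a := a) (b := b)
    (w + (semigroupCurve k ha hab).degShift n)
  rw [(semigroupCurve k ha hab).hochschildCohomologyPiece_eq_map ha0 hx n w]
  exact Module.Finite.map _ _

/-- Rank-nullity for the class map on one graded piece. In degree at least 2 its kernel there is the
injective image under `xDeriv` of the piece lower by `a (b - 1)`. -/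
theorem finrank_hochschildCohomologyPiece (n : ℕ) (w : ℤ) : (Module.finrank k
    (hochschildCohomologyPiece (numericalSemigroupPiece k a b) n w) : ℚ) =
      Module.finrank k
        (numericalSemigroupPiece k a b (w + (semigroupCurve k ha hab).degShift n)) -
      if n ≤ 1 then 0 else (Module.finrank k (numericalSemigroupPiece k a b
        (w + (semigroupCurve k ha hab).degShift n - (a * (b - 1) : ℕ))) : ℚ) := by
  have hx := injective_xDeriv ha hab (natCast_ne_zero_of_coprime hab ha0)
  set C := semigroupCurve k ha hab with hC
  set d := w + C.degShift n
  have := finite_semigroupPiece (k := k) (a := a) (b := b) d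
  have hfr := LinearMap.finrank_range_add_finrank_ker (K := k)
    (V := numericalSemigroupPiece k a b d)
    (V₂ := HochschildCohomology k (numericalSemigroupAlgebra k a b) n)
    ((C.classMap ha0 n).domRestrict (numericalSemigroupPiece k a b d))
  rw [LinearMap.range_domRestrict, ← C.hochschildCohomologyPiece_eq_map ha0 hx n w] at hfr
  rw [← hfr, Nat.cast_add, eq_sub_iff_add_eq, add_right_inj]
  have hk := C.ker_classMap ha0 n
  have hker : (LinearMap.ker ((C.classMap ha0 n).domRestrict
      (numericalSemigroupPiece k a b d))).map (numericalSemigroupPiece k a b d).subtype =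
      (numericalSemigroupPiece k a b (d - (a * (b - 1) : ℕ))).map (C.boundary n) := by
    apply le_antisymm
    · rintro _ ⟨⟨z, hz⟩, hzk, rfl⟩
      have hzk' : z ∈ LinearMap.ker (C.classMap ha0 n) := hzk
      rw [hk] at hzk'
      obtain ⟨t, rfl⟩ := hzk'
      exact exists_boundary_eq ha hab n hz t fun _ _ => rfl
    · rintro _ ⟨z, hz, rfl⟩
      refine ⟨⟨C.boundary n z, boundary_mem ha hab n hz⟩, ?_, rfl⟩
      have : C.boundary n z ∈ LinearMap.ker (C.classMap ha0 n) := by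
        rw [hk]
        exact ⟨z, rfl⟩
      exact this
  rw [← Submodule.finrank_map_subtype_eq, hker]
  split_ifs with hn
  · rw [QuasiHomogeneousCurve.boundary, if_pos hn, Submodule.map_zero, finrank_bot, Nat.cast_zero]
  · rw [QuasiHomogeneousCurve.boundary, if_neg hn]
    exact congrArg _ (Submodule.equivMapOfInjective _ hx _).finrank_eq

end cohomology

end Semigroup

/-! ### The Hilbert series -/

section series

variable (U V W H : LaurentSeries ℚ)

/-- Multiplying by the denominator `1 - X² U` turns the left side into `1 - X² U V`, and the claimed
coefficients satisfy the same two-step recursion. The test `n ≤ 1` singles out `n = 0` here, and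
covers `n = 1` once the odd factor is multiplied in. -/
theorem coeff_one_add_geometric (n : ℕ) :
    PowerSeries.coeff n (1 + PowerSeries.X ^ 2 * PowerSeries.C U *
      (1 - PowerSeries.X ^ 2 * PowerSeries.C U)⁻¹ * (1 - PowerSeries.C V)) =
      if Even n then U ^ (n / 2) * (if n ≤ 1 then 1 else 1 - V) else 0 := by
  set q : PowerSeries (LaurentSeries ℚ) := 1 - PowerSeries.X ^ 2 * PowerSeries.C U with hq
  have hq0 : PowerSeries.constantCoeff q ≠ 0 := by simp [hq]
  have hq1 : q ≠ 0 := fun h => hq0 (by rw [h, map_zero])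
  have key : 1 + PowerSeries.X ^ 2 * PowerSeries.C U * q⁻¹ * (1 - PowerSeries.C V) =
      PowerSeries.mk fun n =>
        if Even n then U ^ (n / 2) * (if n ≤ 1 then 1 else 1 - V) else 0 := by
    refine mul_left_cancel₀ hq1 ?_
    have h1 : q * (1 + PowerSeries.X ^ 2 * PowerSeries.C U * q⁻¹ * (1 - PowerSeries.C V)) =
        1 - PowerSeries.X ^ 2 * PowerSeries.C (U * V) := by
      have := PowerSeries.mul_inv_cancel q hq0
      rw [map_mul]
      linear_combination (PowerSeries.X ^ 2 * PowerSeries.C U * (1 - PowerSeries.C V)) * this + hq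
    rw [h1, hq, sub_mul, one_mul, mul_assoc]
    ext1 n
    rw [map_sub, map_sub, PowerSeries.coeff_X_pow_mul', PowerSeries.coeff_X_pow_mul',
      PowerSeries.coeff_C_mul, PowerSeries.coeff_mk]
    rcases n with _ | _ | n
    · simp
    · simp [PowerSeries.coeff_one]
    · simp only [if_pos (show 2 ≤ n + 1 + 1 by omega), show n + 1 + 1 - 2 = n by omega,
        PowerSeries.coeff_mk, PowerSeries.coeff_one, PowerSeries.coeff_C,
        if_neg (show ¬n + 1 + 1 = 0 by omega), if_neg (show ¬n + 1 + 1 ≤ 1 by omega),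
        show (n + 1 + 1) / 2 = n / 2 + 1 by omega, Nat.even_add_one, not_not]
      rcases n with _ | _ | n
      · simp
        ring
      · simp
      · rw [if_neg (by omega), if_neg (by omega : ¬n + 1 + 1 ≤ 1)]
        split_ifs <;> ring
  rw [key, PowerSeries.coeff_mk]

theorem coeff_hochschildSeries (n : ℕ) :
    PowerSeries.coeff n ((1 + PowerSeries.X ^ 2 * PowerSeries.C U *
      (1 - PowerSeries.X ^ 2 * PowerSeries.C U)⁻¹ * (1 - PowerSeries.C V)) *
      (1 + PowerSeries.X * PowerSeries.C W) * PowerSeries.C H) =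
      U ^ (n / 2) * (if Even n then 1 else W) * (if n ≤ 1 then 1 else 1 - V) * H := by
  rw [PowerSeries.coeff_mul_C, mul_add, mul_one, map_add, ← mul_assoc, PowerSeries.coeff_mul_C,
    coeff_one_add_geometric]
  congr 1
  rcases n with _ | n
  · simp
  · rw [PowerSeries.coeff_succ_mul_X, coeff_one_add_geometric]
    simp only [Nat.even_add_one]
    by_cases hn : Even n
    · have h1 : (n + 1) / 2 = n / 2 := by obtain ⟨m, rfl⟩ := hn; omega
      have h2 : n ≤ 1 ↔ n + 1 ≤ 1 := by obtain ⟨m, rfl⟩ := hn; omega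
      simp only [hn, not_true, if_true, if_false, h1, h2]
      ring
    · simp only [hn, not_false_eq_true, if_true, if_false]
      ring

end series

theorem coeff_single_pow_mul {d e N w : ℤ} (m : ℕ) (H : LaurentSeries ℚ) (p q : Prop) [Decidable p]
    [Decidable q] :
    (HahnSeries.single d (1 : ℚ) ^ m * (if p then 1 else HahnSeries.single e 1) *
      (if q then 1 else 1 - HahnSeries.single N 1) * H).coeff w =
      H.coeff (w - (m * d + if p then 0 else e)) -
        if q then 0 else H.coeff (w - (m * d + if p then 0 else e) - N) := by
  have h : HahnSeries.single d (1 : ℚ) ^ m * (if p then 1 else HahnSeries.single e 1) =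
      HahnSeries.single (m * d + if p then 0 else e) (1 : ℚ) := by
    rw [HahnSeries.single_pow, one_pow, nsmul_eq_mul]
    split_ifs
    · rw [mul_one, add_zero]
    · rw [HahnSeries.single_mul_single, one_mul]
  rw [h]
  by_cases hq : q
  · rw [if_pos hq, if_pos hq, mul_one, HahnSeries.coeff_single_mul, one_mul, sub_zero]
  · rw [if_neg hq, if_neg hq, mul_assoc, HahnSeries.coeff_single_mul, one_mul, sub_mul, one_mul, HahnSeries.coeff_sub,
      HahnSeries.coeff_single_mul, one_mul]

theorem degShift_semigroupCurve {k : Type u} [Field k] {a b : ℕ} (ha : 0 < a) (hab : a.Coprime b)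
    (n : ℕ) : (semigroupCurve k ha hab).degShift n =
      ((n / 2 : ℕ) : ℤ) * (a * b) + if Even n then 0 else (b : ℤ) := by
  rcases n with _ | n
  · simp [QuasiHomogeneousCurve.degShift]
  · simp only [QuasiHomogeneousCurve.degShift, Nat.even_add_one]
    by_cases hn : Even n
    · rw [if_pos hn, QuasiHomogeneousCurve.shift_even _ hn, if_neg (not_not.2 hn),
        show (n + 1) / 2 = n / 2 by obtain ⟨m, rfl⟩ := hn; omega]
      rfl
    · rw [if_neg hn, QuasiHomogeneousCurve.shift_odd _ hn, if_pos hn,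
        show (n + 1) / 2 = n / 2 + 1 by obtain ⟨m, rfl⟩ := Nat.not_even_iff_odd.1 hn; omega]
      change ((n / 2 : ℕ) : ℤ) * (a * b) + a * b = _
      push_cast
      ring

end

theorem mainTheorem6 (k : Type*) [Field k] (a b : ℕ) (ha : 0 < a) (hb : 0 < b)
    (hab : Nat.Coprime a b) (hchar : ringChar k ∣ a) :
    (∀ m : ℕ, DirectSum.IsInternal
      (hochschildCohomologyPiece (numericalSemigroupPiece k a b) m)) ∧
    IsBigradedHilbertSeries
      (fun m => hochschildCohomologyPiece (numericalSemigroupPiece k a b) m)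
      ((1 + PowerSeries.X ^ 2 * yPow (-((a : ℤ) * b))
            * (1 - PowerSeries.X ^ 2 * yPow (-((a : ℤ) * b)))⁻¹
            * (1 - yPow ((a : ℤ) * ((b : ℤ) - 1))))
        * (1 + PowerSeries.X * yPow (-(b : ℤ)))
        * PowerSeries.C (numericalSemigroupHilbertSeries k a b)) := by
  have ha0 : (a : k) = 0 := (ringChar.spec k a).2 hchar
  refine ⟨isInternal_hochschildCohomologyPiece ha hab ha0, fun m n =>
    ⟨finite_hochschildCohomologyPiece ha hab ha0 m n, ?_⟩⟩
  rw [finrank_hochschildCohomologyPiece ha hab ha0, degShift_semigroupCurve]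
  simp only [yPow]
  rw [coeff_hochschildSeries, coeff_single_pow_mul, coeff_numericalSemigroupHilbertSeries,
    coeff_numericalSemigroupHilbertSeries]
  -- A factor `y^(-c)` reads off the coefficient of the Hilbert series at `n + c`, matching the
  -- shift of weights.
  have h1 : n - (((m / 2 : ℕ) : ℤ) * (-((a : ℤ) * b)) + if Even m then 0 else -(b : ℤ)) =
      n + (((m / 2 : ℕ) : ℤ) * (a * b) + if Even m then 0 else (b : ℤ)) := by
    split_ifs <;> ring
  -- Truncated subtraction agrees with the integer one because `b` is positive.
  have h2 : ((a * (b - 1) : ℕ) : ℤ) = (a : ℤ) * ((b : ℤ) - 1) := by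
    push_cast [Nat.one_le_iff_ne_zero.2 hb.ne']
    rfl
  rw [h1, h2]
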